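/- **Setting.** Let $f$ be a self-map of a compact space $\operatorname{dom}(f)$ of one of two kinds. (Real case) $\operatorname{dom}(f)=I$ is a compact interval of $\mathbb{R}$ with the usual distance. The map $f:I\to I$ is differentiable with finitely many critical points (zeros of $f'$) and is of class $C^3$ outside them. For each critical point $c$ there are $\ell_c>1$ and $C^3$ diffeomorphisms $\phi,\psi$ of $\mathbb{R}$ with $\phi(c)=\psi(f(c))=0$ and $|\psi\circ f|=|\phi|^{\ell_c}$ near $c$ in $I$. The Julia set $J(f)$ has at least two points and is completely invariant ($f^{-1}(J(f))=J(f)$). Moreover $f$ is topologically exact on $J(f)$: every non-empty relatively open subset of $J(f)$ is mapped onto $J(f)$ by some iterate of $f$. (Complex case) $\operatorname{dom}(f)=\overline{\mathbb{C}}$ is the Riemann sphere with the spherical metric, and $f$ is a rational map of degree at least $2$. In both cases the Julia set $J(f)$ is the complement of the largest open subset of $\operatorname{dom}(f)$ on which the iterates of $f$ form a normal family. For $V\subseteq \operatorname{dom}(f)$ and $n\ge1$, a *pull-back* of $V$ by $f^n$ is a connected component of $f^{-n}(V)$. For $\varphi:J(f)\to\mathbb{R}$ put $S_n(\varphi)=\sum_{i=0}^{n-1}\varphi\circ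 f^i$ on $J(f)$. Let $B_0\subseteq \operatorname{dom}(f)$ be a compact connected set intersecting $J(f)$. An *iterated multivalued function system (IMFS) generated by $f$ and defined on $B_0$*, with *time sequence* $(m_l)_{l\ge1}$, is a sequence of multivalued functions $(\phi_l)_{l\ge 1}$ such that for every $l$ we have $m_l\ge1$, and there is a pull-back $W_l\subseteq B_0$ of $B_0$ by $f^{m_l}$ with $f^{m_l}(W_l)=B_0$ and $\phi_l=(f^{m_l}|_{W_l})^{-1}$, that is, $\phi_l(x)=\{y\in W_l: f^{m_l}(y)=x\}$ for $x\in B_0$; put $\phi_l(A)=\bigcup_{x\in A}\phi_l(x)$. For a finite non-empty word $\underline{l}=l_1\cdots l_k$ in the alphabet $\{1,2,\dots\}$ put $m_{\underline l}=m_{l_1}+\dots+m_{l_k}$ and $\phi_{\underline l}=\phi_{l_1}\circ\dots\circ\phi_{l_k}$, where $(\phi\circ\psi)(x)=\bigcup_{y\in\psi(x)}\phi(y)$. The IMFS is *free* if there is $x\in B_0$ such that for all distinct non-empty words $\underline l,\underline l'$ with $m_{\underline l}=m_{\underline l'}$ the sets $\phi_{\underline l}(x)$ and $\phi_{\underline l'}(x)$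 are disjoint. **Proposition.** Let $\beta>1$, and let $f$ be as above and satisfy the Polynomial Shrinking Condition with exponent $\beta$: there are $\rho_0>0$ and $C_0>0$ such that for every $x\in J(f)$, every integer $n\ge1$ and every connected component $W$ of $f^{-n}(B(x,\rho_0))$ we have $\operatorname{diam}(W)\le C_0n^{-\beta}$. Let $\alpha\in(\beta^{-1},1]$, let $\varphi:J(f)\to\mathbb{R}$ be Hölder continuous of exponent $\alpha$, and let $\nu$ be an ergodic invariant Borel probability measure on $J(f)$ that is not supported on a periodic orbit. Then there is a subset $X$ of $J(f)$ of full measure for $\nu$ such that for every $x_0\in X$ there exist $D>0$, a compact connected subset $B_0$ of $\operatorname{dom}(f)$ containing $x_0$, and a free IMFS $(\phi_l)_{l\ge1}$ generated by $f$, defined on $B_0$, with time sequence $(m_l)_{l\ge1}$, such that for every $l\ge1$ and every $y\in\phi_l(B_0)\cap J(f)$, $$S_{m_l}(\varphi)(y)\ \ge\ m_l\int_{J(f)}\varphi\,d\nu-D.$$ -/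

import Mathlib

open Set Filter Topology MeasureTheory Polynomial
open scoped Manifold ContDiff NNReal

noncomputable section

/-! ## Julia sets, pull-backs and iterated multivalued function systems

Everything in this part makes sense for a self-map `f` of a metric space `X`, the domain of `f`. -/

section General

variable {X : Type*} [MetricSpace X]

/-- The family of iterates of `f` is normal on `U`: every sequence of iterates has a subsequence
that converges locally uniformly on `U`. -/
def IteratesNormalOn (f : X → X) (U : Set X) : Prop :=
  ∀ s : ℕ → ℕ, ∃ θ : ℕ → ℕ, StrictMono θ ∧
    ∃ g : X → X, TendstoLocallyUniformlyOn (fun k => f^[s (θ k)]) g atTop U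

/-- The largest open set on which the iterates of `f` form a normal family. -/
def fatouSet (f : X → X) : Set X :=
  ⋃₀ {U : Set X | IsOpen U ∧ IteratesNormalOn f U}

/-- The Julia set of `f`. -/
def juliaSet (f : X → X) : Set X := (fatouSet f)ᶜ

/-- `W` is a pull-back of `V` by `f^n`: a connected component of `f^{-n}(V)`. -/
def IsPullBack (f : X → X) (n : ℕ) (V W : Set X) : Prop :=
  ∃ x ∈ f^[n] ⁻¹' V, W = connectedComponentIn (f^[n] ⁻¹' V) x

/-- The Polynomial Shrinking (of Components) Condition with exponent `β`. -/
def PolynomialShrinking (f : X → X) (β : ℝ) : Prop :=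
  ∃ ρ₀ > (0 : ℝ), ∃ C₀ > (0 : ℝ), ∀ x ∈ juliaSet f, ∀ n : ℕ, 1 ≤ n → ∀ W : Set X,
    IsPullBack f n (Metric.ball x ρ₀) W → Metric.diam W ≤ C₀ * (n : ℝ) ^ (-β)

/-- `f` is topologically exact on its Julia set: every non-empty relatively open subset of the
Julia set is mapped onto the whole Julia set by some iterate of `f`. -/
def TopologicallyExactOnJulia (f : X → X) : Prop :=
  ∀ U : Set X, IsOpen U → (U ∩ juliaSet f).Nonempty →
    ∃ n : ℕ, f^[n] '' (U ∩ juliaSet f) = juliaSet f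

/-- The measure `ν` is supported on a periodic orbit of `f`. -/
def SupportedOnPeriodicOrbit [MeasurableSpace X] (f : X → X) (ν : Measure X) : Prop :=
  ∃ p ∈ Function.periodicPts f, ν (range fun k : ℕ => f^[k] p)ᶜ = 0

/-- The composition `φ ∘ ψ` of multivalued functions. -/
def multiComp (φ ψ : X → Set X) : X → Set X := fun x => ⋃ y ∈ ψ x, φ y

/-- An Iterated Multivalued Function System generated by `f` and defined on `B₀`, given by its time
sequence `m_l = time l` and by the pull-backs `W_l = dom l`. The sequence is indexed by `ℕ`. -/
structure IMFS (f : X → X) (B₀ : Set X) where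
  isCompact_base : IsCompact B₀
  isConnected_base : IsConnected B₀
  base_inter_julia : (B₀ ∩ juliaSet f).Nonempty
  time : ℕ → ℕ
  dom : ℕ → Set X
  one_le_time : ∀ l, 1 ≤ time l
  isPullBack_dom : ∀ l, IsPullBack f (time l) B₀ (dom l)
  dom_subset : ∀ l, dom l ⊆ B₀
  image_dom : ∀ l, f^[time l] '' dom l = B₀

namespace IMFS

variable {f : X → X} {B₀ : Set X} (Φ : IMFS f B₀)

/-- The multivalued function `φ_l = (f^{m_l}|_{W_l})⁻¹`. -/
def branch (l : ℕ) : X → Set X := fun x => {y | y ∈ Φ.dom l ∧ f^[Φ.time l] y = x}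

/-- The image `φ_l(A)` of a set under `φ_l`. -/
def branchImage (l : ℕ) (A : Set X) : Set X := ⋃ x ∈ A, Φ.branch l x

/-- `m_w = m_{l_1} + ⋯ + m_{l_k}` for a word `w = l_1 ⋯ l_k`. -/
def wordTime (w : List ℕ) : ℕ := (w.map Φ.time).sum

/-- `φ_w = φ_{l_1} ∘ ⋯ ∘ φ_{l_k}` for a word `w = l_1 ⋯ l_k`; the empty word, which is not used
below, gives the identity. -/
def wordBranch (w : List ℕ) : X → Set X :=
  w.foldr (fun l ψ => multiComp (Φ.branch l) ψ) (fun x => {x})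

/-- The IMFS is free. -/
def IsFree : Prop :=
  ∃ x ∈ B₀, ∀ w w' : List ℕ, w ≠ [] → w' ≠ [] → w ≠ w' → Φ.wordTime w = Φ.wordTime w' →
    Disjoint (Φ.wordBranch w x) (Φ.wordBranch w' x)

end IMFS

end General

/-! ## Interval maps -/

section Interval

variable {a b : ℝ}

/-- An interval map as a real function, extended by constants outside of `[a, b]`. Only its values
on `[a, b]` are used. -/
def intervalFun (hab : a ≤ b) (f : Icc a b → Icc a b) : ℝ → ℝ :=
  IccExtend hab fun x => (f x : ℝ)

/-- The set of critical points, as a subset of the real line. -/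
def intervalCrit (hab : a ≤ b) (f : Icc a b → Icc a b) : Set ℝ :=
  {c | c ∈ Icc a b ∧ derivWithin (intervalFun hab f) (Icc a b) c = 0}

/-- `f : [a, b] → [a, b]` is of class `C³` with non-flat critical points. -/
structure IsC3NonFlat (hab : a ≤ b) (f : Icc a b → Icc a b) : Prop where
  differentiable : DifferentiableOn ℝ (intervalFun hab f) (Icc a b)
  finite_crit : (intervalCrit hab f).Finite
  contDiffOn : ContDiffOn ℝ 3 (intervalFun hab f) (Icc a b \ intervalCrit hab f)
  nonFlat : ∀ c ∈ intervalCrit hab f, ∃ ℓ : ℝ, 1 < ℓ ∧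
    ∃ φ ψ : Diffeomorph 𝓘(ℝ, ℝ) 𝓘(ℝ, ℝ) ℝ ℝ 3,
      φ c = 0 ∧ ψ (intervalFun hab f c) = 0 ∧
      ∀ᶠ x in 𝓝[Icc a b] c, |ψ (intervalFun hab f x)| = |φ x| ^ ℓ

/-- The class `𝒜_ℝ`: interval maps of class `C³` with non-flat critical points, whose Julia set
contains at least two points and is completely invariant. -/
structure IsClassAReal (hab : a ≤ b) (f : Icc a b → Icc a b) : Prop where
  isC3NonFlat : IsC3NonFlat hab f
  nontrivial_julia : (juliaSet f).Nontrivial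
  completelyInvariant : f ⁻¹' juliaSet f = juliaSet f

end Interval

/-! ## The Riemann sphere and rational maps -/

/-- The Riemann sphere. -/
def RiemannSphere : Type := OnePoint ℂ

namespace RiemannSphere

instance : TopologicalSpace RiemannSphere := inferInstanceAs (TopologicalSpace (OnePoint ℂ))

instance : CompactSpace RiemannSphere := inferInstanceAs (CompactSpace (OnePoint ℂ))

/-- The point at infinity. -/
def infty : RiemannSphere := OnePoint.infty

/-- The inclusion of the complex plane. -/
def ofComplex (z : ℂ) : RiemannSphere := (z : OnePoint ℂ)

/-- Inverse stereographic projection of the plane to the unit sphere of `ℝ³`. -/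
def stereoPlane (z : ℂ) : EuclideanSpace ℝ (Fin 3) :=
  !₂[2 * z.re / (1 + ‖z‖ ^ 2), 2 * z.im / (1 + ‖z‖ ^ 2), (‖z‖ ^ 2 - 1) / (1 + ‖z‖ ^ 2)]

/-- Inverse stereographic projection; infinity goes to the north pole. -/
def stereo (p : RiemannSphere) : EuclideanSpace ℝ (Fin 3) :=
  OnePoint.elim p (!₂[0, 0, 1] : EuclideanSpace ℝ (Fin 3)) stereoPlane

theorem norm_stereoPlane (z : ℂ) : ‖stereoPlane z‖ = 1 := by
  have h0 : (1 + ‖z‖ ^ 2) ≠ 0 := by positivity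
  have h1 : ‖z‖ ^ 2 = z.re ^ 2 + z.im ^ 2 := by
    rw [Complex.sq_norm, Complex.normSq_apply]; ring
  have h2 : ‖stereoPlane z‖ ^ 2 = 1 := by
    rw [EuclideanSpace.norm_sq_eq]
    simp only [stereoPlane, Fin.sum_univ_three, Real.norm_eq_abs, sq_abs, PiLp.toLp_apply,
      Matrix.cons_val_zero, Matrix.cons_val_one, Matrix.cons_val]
    field_simp
    rw [h1]; ring
  nlinarith [norm_nonneg (stereoPlane z)]

theorem norm_stereo (p : RiemannSphere) : ‖stereo p‖ = 1 := by
  induction p using OnePoint.rec with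
  | infty =>
    change ‖(!₂[0, 0, 1] : EuclideanSpace ℝ (Fin 3))‖ = 1
    simp [EuclideanSpace.norm_eq, Fin.sum_univ_three]
  | coe z => exact norm_stereoPlane z

theorem stereo_ne_zero (p : RiemannSphere) : stereo p ≠ 0 := by
  intro h
  have := norm_stereo p
  simp [h] at this

theorem stereoPlane_two (z : ℂ) : stereoPlane z 2 = 1 - 2 / (1 + ‖z‖ ^ 2) := by
  have h0 : (1 + ‖z‖ ^ 2) ≠ 0 := by positivity
  change (‖z‖ ^ 2 - 1) / (1 + ‖z‖ ^ 2) = _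
  field_simp
  ring

theorem stereo_injective : Function.Injective stereo := by
  intro p q h
  induction p using OnePoint.rec with
  | infty =>
    induction q using OnePoint.rec with
    | infty => rfl
    | coe w =>
      exfalso
      have h2 : (1 : ℝ) = stereoPlane w 2 := congrArg (fun v => v 2) h
      rw [stereoPlane_two] at h2
      have : 0 < 2 / (1 + ‖w‖ ^ 2) := by positivity
      linarith
  | coe z =>
    induction q using OnePoint.rec with
    | infty =>
      exfalso
      have h2 : stereoPlane z 2 = (1 : ℝ) := congrArg (fun v => v 2) h
      rw [stereoPlane_two] at h2
      have : 0 < 2 / (1 + ‖z‖ ^ 2) := by positivity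
      linarith
    | coe w =>
      have hz : (1 + ‖z‖ ^ 2) ≠ 0 := by positivity
      have hw : (1 + ‖w‖ ^ 2) ≠ 0 := by positivity
      have h2 : stereoPlane z 2 = stereoPlane w 2 := congrArg (fun v => v 2) h
      have h0 : 2 * z.re / (1 + ‖z‖ ^ 2) = 2 * w.re / (1 + ‖w‖ ^ 2) :=
        congrArg (fun v => v 0) h
      have h1 : 2 * z.im / (1 + ‖z‖ ^ 2) = 2 * w.im / (1 + ‖w‖ ^ 2) :=
        congrArg (fun v => v 1) h
      rw [stereoPlane_two, stereoPlane_two] at h2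
      have h3 : 1 + ‖z‖ ^ 2 = 1 + ‖w‖ ^ 2 := by
        have h4 : 2 / (1 + ‖z‖ ^ 2) = 2 / (1 + ‖w‖ ^ 2) := by linarith
        field_simp at h4
        linarith
      rw [h3] at h0 h1
      have hre : z.re = w.re := by
        field_simp at h0
        exact h0
      have him : z.im = w.im := by
        field_simp at h1
        exact h1
      exact congrArg ofComplex (Complex.ext hre him)

theorem continuous_stereo : Continuous stereo := by
  refine (OnePoint.continuous_iff (X := ℂ) stereo).2 ⟨?_, ?_⟩
  · rw [coclosedCompact_eq_cocompact, tendsto_iff_norm_sub_tendsto_zero]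
    have hnorm : Tendsto (fun z : ℂ => 1 + ‖z‖ ^ 2) (cocompact ℂ) atTop :=
      tendsto_atTop_add_const_left _ _
        ((tendsto_pow_atTop two_ne_zero).comp (tendsto_norm_cocompact_atTop (E := ℂ)))
    have key : ∀ z : ℂ, ‖stereoPlane z - !₂[0, 0, 1]‖ = √(4 / (1 + ‖z‖ ^ 2)) := by
      intro z
      have h0 : (1 + ‖z‖ ^ 2) ≠ 0 := by positivity
      have h1 : ‖z‖ ^ 2 = z.re ^ 2 + z.im ^ 2 := by
        rw [Complex.sq_norm, Complex.normSq_apply]; ring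
      rw [EuclideanSpace.norm_eq]
      congr 1
      simp only [stereoPlane, Fin.sum_univ_three, Real.norm_eq_abs, sq_abs,
        PiLp.sub_apply, Matrix.cons_val_zero, Matrix.cons_val_one, Matrix.cons_val]
      field_simp
      rw [h1]; ring
    have hlim : Tendsto (fun z : ℂ => √(4 / (1 + ‖z‖ ^ 2))) (cocompact ℂ) (𝓝 0) := by
      have := (Real.continuous_sqrt.tendsto 0).comp (hnorm.const_div_atTop 4)
      simpa [Function.comp_def] using this
    exact hlim.congr fun z => (key z).symm
  · change Continuous stereoPlane
    have h0 : ∀ z : ℂ, (1 + ‖z‖ ^ 2) ≠ 0 := fun z => by positivity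
    refine (PiLp.continuous_toLp 2 _).comp (continuous_pi fun i => ?_)
    fin_cases i
    · exact (continuous_const.mul Complex.continuous_re).div (by fun_prop) h0
    · exact (continuous_const.mul Complex.continuous_im).div (by fun_prop) h0
    · exact ((continuous_norm.pow 2).sub continuous_const).div (by fun_prop) h0

/-- The spherical distance: the length of the shortest arc of the unit sphere between the
stereographic images. -/
def sphericalDist (p q : RiemannSphere) : ℝ :=
  InnerProductGeometry.angle (stereo p) (stereo q)

theorem continuous_sphericalDist (p : RiemannSphere) : Continuous (sphericalDist p) := by
  rw [continuous_iff_continuousAt]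
  intro q
  exact (InnerProductGeometry.continuousAt_angle (x := (stereo p, stereo q))
    (stereo_ne_zero p) (stereo_ne_zero q)).comp
      (f := fun r => (stereo p, stereo r))
      (continuous_const.prodMk continuous_stereo).continuousAt

theorem sphericalDist_self (p : RiemannSphere) : sphericalDist p p = 0 :=
  InnerProductGeometry.angle_self (stereo_ne_zero p)

theorem eq_of_sphericalDist_eq_zero (p q : RiemannSphere) (h : sphericalDist p q = 0) :
    p = q := by
  obtain ⟨-, r, hr, hrq⟩ := InnerProductGeometry.angle_eq_zero_iff.1 h
  have h1 := norm_stereo q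
  rw [hrq, norm_smul, norm_stereo, Real.norm_of_nonneg hr.le, mul_one] at h1
  rw [h1, one_smul] at hrq
  exact stereo_injective hrq.symm

theorem isOpen_iff_sphericalDist (s : Set RiemannSphere) :
    IsOpen s ↔ ∀ x ∈ s, ∃ ε > 0, ∀ y, sphericalDist x y < ε → y ∈ s := by
  constructor
  · intro hs x hx
    by_cases hne : (sᶜ : Set RiemannSphere).Nonempty
    · obtain ⟨y₀, hy₀, hmin⟩ := hs.isClosed_compl.isCompact.exists_isMinOn hne
        (continuous_sphericalDist x).continuousOn
      refine ⟨sphericalDist x y₀, ?_, fun y hy => ?_⟩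
      · refine lt_of_le_of_ne (InnerProductGeometry.angle_nonneg _ _) fun h => ?_
        exact hy₀ (eq_of_sphericalDist_eq_zero _ _ h.symm ▸ hx)
      · by_contra hys
        exact absurd (hmin hys) (not_le.2 hy)
    · rw [not_nonempty_iff_eq_empty, compl_empty_iff] at hne
      exact ⟨1, one_pos, fun y _ => hne ▸ mem_univ y⟩
  · intro H
    rw [isOpen_iff_mem_nhds]
    intro x hx
    obtain ⟨ε, hε, hs⟩ := H x hx
    have : {y | sphericalDist x y < ε} ∈ 𝓝 x :=
      (isOpen_lt (continuous_sphericalDist x) continuous_const).mem_nhds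
        (by simpa [sphericalDist_self] using hε)
    exact mem_of_superset this hs

/-- The spherical metric on the Riemann sphere; it induces the topology of the one-point
compactification. -/
instance : MetricSpace RiemannSphere :=
  MetricSpace.ofDistTopology sphericalDist sphericalDist_self
    (fun _ _ => InnerProductGeometry.angle_comm _ _)
    (fun _ _ _ => InnerProductGeometry.angle_le_angle_add_angle _ _ _)
    isOpen_iff_sphericalDist eq_of_sphericalDist_eq_zero

instance : MeasurableSpace RiemannSphere := borel RiemannSphere

instance : BorelSpace RiemannSphere := ⟨rfl⟩

end RiemannSphere

/-- The value of `p / q` at a point of the Riemann sphere. At infinity one compares the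
coefficients of degree `max (deg p) (deg q)`. It is meant for coprime `p` and `q`. -/
def rationalMap (p q : ℂ[X]) (x : RiemannSphere) : RiemannSphere :=
  OnePoint.elim x
    (if q.coeff (max p.natDegree q.natDegree) = 0 then RiemannSphere.infty
      else RiemannSphere.ofComplex (p.coeff (max p.natDegree q.natDegree) /
        q.coeff (max p.natDegree q.natDegree)))
    (fun z : ℂ => if q.eval z = 0 then RiemannSphere.infty
      else RiemannSphere.ofComplex (p.eval z / q.eval z))

/-- The class `𝒜_ℂ`: complex rational maps of degree at least two. -/
def IsClassAComplex (f : RiemannSphere → RiemannSphere) : Prop :=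
  ∃ p q : ℂ[X], IsCoprime p q ∧ 2 ≤ max p.natDegree q.natDegree ∧ f = rationalMap p q

end

/-! ### Mean ergodic theorem -/

section ErgodicTheory

variable {Ω : Type*} [MeasurableSpace Ω] {μ : Measure Ω} {f : Ω → Ω}

/-! Let `B₀` be a small compact connected set around a point `x₀` of the support of `ν`, and let `A
⊆ B₀` be open with `ν A > 0`. Almost every `y ∈ A` returns to `A` at infinitely many times `n` with
`S_n(φ)(y) ≥ n ∫ φ - 1` (`Ergodic.ae_frequently_birkhoffSum_ge`). Birkhoff's theorem would only give
an error `o(n)`. The bounded error comes from recurrence: if all late returns to a set `E` had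
centred sums at most `-1`, the sums would drop linearly in the number of visits to `E`, which the
mean ergodic theorem forbids unless `E` is null.

Since `αβ > 1`, the series of `(C₀ n^{-β})^α` converges. Hence Birkhoff sums of `φ` vary by a
bounded amount on the Julia points of connected pull-backs (`exists_abs_birkhoffSum_sub_le`), and a
pull-back `W` of `B₀` that follows a good return of `y` inherits the lower bound up to a constant.

It remains to find `W` with `f^{n+k}(W) = B₀` and `k` bounded. A rational map is open, so every
component of the preimage of `B₀` is mapped onto `B₀`, and `k = 0`. An interval map may fold. There
the image under `f^n` of an interval starting at `y` runs from `A` to an endpoint of `B₀`, so it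
covers one of two fixed outer pieces meeting the Julia set, and topological exactness makes this
piece cover `B₀` after boundedly many more steps.

For freeness (`exists_isFree_IMFS`), `ν` has no atoms, so the points `y` can be taken to accumulate
at some `p ∈ A` without being equal to it. With long return times, `W` is tiny compared with the
distance from `y` to `p`; the successive `W` then lie in disjoint annuli around `p`, and disjoint
domains let one read off the letters of a word from a point of its image. -/

theorem coeFn_birkhoffAverage_compMeasurePreserving (hf : MeasurePreserving f μ μ) {g : Ω → ℝ}
    (hg : MemLp g 2 μ) (n : ℕ) :
    ((birkhoffAverage ℝ (Lp.compMeasurePreservingₗᵢ (E := ℝ) (p := 2) ℝ f hf) _root_.id n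
      (hg.toLp g) : Lp ℝ 2 μ) : Ω → ℝ) =ᵐ[μ] birkhoffAverage ℝ f g n := by
  have key : ∀ i, (((Lp.compMeasurePreservingₗᵢ (E := ℝ) (p := 2) ℝ f hf)^[i] (hg.toLp g) :
      Lp ℝ 2 μ) : Ω → ℝ) =ᵐ[μ] g ∘ f^[i] := by
    intro i
    have h1 : (Lp.compMeasurePreservingₗᵢ (E := ℝ) (p := 2) ℝ f hf)^[i] (hg.toLp g) =
        Lp.compMeasurePreserving f^[i] (hf.iterate i) (hg.toLp g) := by
      rw [← Lp.compMeasurePreserving_iterate]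
      rfl
    rw [h1, Lp.toLp_compMeasurePreserving]
    exact MemLp.coeFn_toLp _
  simp only [birkhoffAverage, birkhoffSum, _root_.id]
  refine (Lp.coeFn_smul _ _).trans ?_
  have h2 : ((∑ i ∈ Finset.range n, (Lp.compMeasurePreservingₗᵢ (E := ℝ) (p := 2) ℝ f hf)^[i]
      (hg.toLp g) : Lp ℝ 2 μ) : Ω → ℝ) =ᵐ[μ] fun x => ∑ i ∈ Finset.range n, g (f^[i] x) := by
    induction n with
    | zero =>
      simp only [Finset.range_zero, Finset.sum_empty]
      exact Lp.coeFn_zero ℝ 2 μ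
    | succ n ih =>
      simp only [Finset.sum_range_succ]
      refine (Lp.coeFn_add _ _).trans ?_
      filter_upwards [ih, key n] with x h3 h4
      rw [Pi.add_apply, h3, h4]
      rfl
  filter_upwards [h2] with x hx
  rw [Pi.smul_apply, hx]
  rfl

/-- The mean ergodic theorem, in `L¹`, for square integrable observables. -/
theorem Ergodic.tendsto_integral_abs_birkhoffAverage_sub [IsProbabilityMeasure μ]
    (hf : Ergodic f μ) {g : Ω → ℝ} (hg : MemLp g 2 μ) :
    Tendsto (fun n => ∫ x, |birkhoffAverage ℝ f g n x - ∫ y, g y ∂μ| ∂μ) atTop (𝓝 0) := by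
  set U := Lp.compMeasurePreservingₗᵢ (E := ℝ) (p := 2) ℝ f hf.toMeasurePreserving with hU
  set T : Lp ℝ 2 μ →L[ℝ] Lp ℝ 2 μ := U.toContinuousLinearMap with hT
  -- Von Neumann's theorem for the Koopman isometry: the averages converge in `L²` to the projection
  -- onto the fixed vectors.
  have hlim := T.tendsto_birkhoffAverage_orthogonalProjection
    (U.norm_toContinuousLinearMap_le) (hg.toLp g)
  set L := (T.eqLocus (1 : Lp ℝ 2 μ →L[ℝ] Lp ℝ 2 μ)).orthogonalProjectionOnto (hg.toLp g)
  have hfix : T (L : Lp ℝ 2 μ) = L := L.2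
  -- By ergodicity, fixed vectors are constant almost everywhere.
  obtain ⟨c, hc⟩ : ∃ c, ((L : Lp ℝ 2 μ) : Ω → ℝ) =ᵐ[μ] Function.const Ω c := by
    refine hf.ae_eq_const_of_ae_eq_comp_ae (Lp.aestronglyMeasurable _) ?_
    have h1 := Lp.coeFn_compMeasurePreserving (L : Lp ℝ 2 μ) hf.toMeasurePreserving
    refine h1.symm.trans ?_
    exact Eventually.of_forall fun x => congrArg (fun F : Lp ℝ 2 μ => (F : Ω → ℝ) x) hfix
  have hint : ∀ i, Integrable (fun x => g (f^[i] x)) μ := fun i =>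
    ((hf.toMeasurePreserving.iterate i).integrable_comp_of_integrable (hg.integrable one_le_two))
  have havg_int : ∀ n, Integrable (birkhoffAverage ℝ f g n) μ := by
    intro n
    exact Integrable.smul (n : ℝ)⁻¹ (integrable_finsetSum (Finset.range n) fun i _ => hint i)
  have hle : ∀ n, ∫ x, |birkhoffAverage ℝ f g n x - c| ∂μ ≤
      ‖birkhoffAverage ℝ T _root_.id n (hg.toLp g) - (L : Lp ℝ 2 μ)‖ := by
    intro n
    set H := birkhoffAverage ℝ T _root_.id n (hg.toLp g) - (L : Lp ℝ 2 μ) with hH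
    have h1 : (fun x => birkhoffAverage ℝ f g n x - c) =ᵐ[μ] H := by
      filter_upwards [Lp.coeFn_sub (birkhoffAverage ℝ T _root_.id n (hg.toLp g)) (L : Lp ℝ 2 μ), hc,
        coeFn_birkhoffAverage_compMeasurePreserving hf.toMeasurePreserving hg n] with x h2 h3 h4
      rw [hH, h2, Pi.sub_apply, h3, ← h4]
      rfl
    have h2 : ∫ x, |birkhoffAverage ℝ f g n x - c| ∂μ = ∫ x, ‖H x‖ ∂μ := by
      refine integral_congr_ae ?_
      filter_upwards [h1] with x hx
      rw [← hx, Real.norm_eq_abs]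
    rw [h2, integral_norm_eq_lintegral_enorm (Lp.aestronglyMeasurable H), Lp.norm_def,
      ← eLpNorm_one_eq_lintegral_enorm]
    exact ENNReal.toReal_mono (Lp.eLpNorm_ne_top H)
      (eLpNorm_le_eLpNorm_of_exponent_le one_le_two (Lp.aestronglyMeasurable H))
  have hnorm : Tendsto (fun n => ‖birkhoffAverage ℝ T _root_.id n (hg.toLp g) - (L : Lp ℝ 2 μ)‖)
      atTop (𝓝 0) := tendsto_iff_norm_sub_tendsto_zero.1 hlim
  have hc0 : Tendsto (fun n => ∫ x, |birkhoffAverage ℝ f g n x - c| ∂μ) atTop (𝓝 0) :=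
    squeeze_zero (fun n => integral_nonneg fun x => abs_nonneg _) hle hnorm
  have hmean : ∀ n : ℕ, n ≠ 0 → ∫ x, birkhoffAverage ℝ f g n x ∂μ = ∫ x, g x ∂μ := by
    intro n hn
    simp only [birkhoffAverage, birkhoffSum]
    rw [integral_smul, integral_finsetSum _ fun i _ => hint i]
    have h3 : ∀ i, ∫ x, g (f^[i] x) ∂μ = ∫ x, g x ∂μ := by
      intro i
      have h4 := (hf.toMeasurePreserving.iterate i)
      conv_rhs => rw [← h4.map_eq]
      rw [integral_map h4.measurable.aemeasurable]
      rw [h4.map_eq]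
      exact hg.1
    have hn' : (n : ℝ) ≠ 0 := Nat.cast_ne_zero.2 hn
    simp [h3, hn']
  -- Averaging preserves the integral, so `L¹` convergence identifies the constant.
  have hcg : c = ∫ x, g x ∂μ := by
    have h5 : ∀ᶠ n : ℕ in atTop, |(∫ x, g x ∂μ) - c| ≤
        ∫ x, |birkhoffAverage ℝ f g n x - c| ∂μ := by
      filter_upwards [eventually_ne_atTop 0] with n hn
      rw [← hmean n hn]
      have h6 : (∫ x, birkhoffAverage ℝ f g n x ∂μ) - c =
          ∫ x, (birkhoffAverage ℝ f g n x - c) ∂μ := by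
        rw [integral_sub (havg_int n) (integrable_const c)]
        simp
      rw [h6]
      exact abs_integral_le_integral_abs
    have h7 := ge_of_tendsto hc0 h5
    have h8 := abs_nonpos_iff.1 h7
    linarith
  rw [← hcg]
  exact hc0

end ErgodicTheory

/-! ### Recurrence with good Birkhoff sums -/

section Recurrence

variable {Ω : Type*} [MeasurableSpace Ω] {μ : Measure Ω} {f : Ω → Ω}

theorem abs_birkhoffSum_le {Ω : Type*} (f : Ω → Ω) {g : Ω → ℝ} {M : ℝ}
    (hM : ∀ x, |g x| ≤ M) (n : ℕ) (x : Ω) :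
    |birkhoffSum f g n x| ≤ n * M := by
  refine (Finset.abs_sum_le_sum_abs _ _).trans ?_
  refine (Finset.sum_le_sum fun i _ => hM _).trans ?_
  simp

/-- If the Birkhoff sums of `g` are at most `-1` at all returns to `E` after time `N`, then at
returns they drop at least at the rate of `1 / N` per visit to `E`. -/
theorem birkhoffSum_le_sub_visits_div {Ω : Type*} (f : Ω → Ω) {g : Ω → ℝ} {M : ℝ}
    (hM : ∀ x, |g x| ≤ M) {E : Set Ω} {N : ℕ} (hN : 1 ≤ N)
    (hE : ∀ x ∈ E, ∀ n, N ≤ n → f^[n] x ∈ E → birkhoffSum f g n x ≤ -1) (n : ℕ) :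
    ∀ x ∈ E, f^[n] x ∈ E →
      birkhoffSum f g n x ≤ N * M + 1 - birkhoffSum f (E.indicator (1 : Ω → ℝ)) n x / N := by
  classical
  have hN0 : (0 : ℝ) < N := by exact_mod_cast hN
  have hind : ∀ x, |E.indicator (1 : Ω → ℝ) x| ≤ 1 := by
    intro x
    by_cases hx : x ∈ E <;> simp [hx]
  induction n using Nat.strong_induction_on with
  | _ n ih =>
    intro x hx hnx
    have hM0 : 0 ≤ M := (abs_nonneg _).trans (hM x)
    -- For `n < N` the sum is at most `N * M` and the visits divided by `N` are at most `1`: this is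
    -- the constant `N * M + 1`.
    rcases lt_or_ge n N with hnN | hnN
    · have h1 := (abs_le.1 (abs_birkhoffSum_le f hM n x)).2
      have h2 := (abs_le.1 (abs_birkhoffSum_le f hind n x)).2
      have hn : (n : ℝ) ≤ N := by exact_mod_cast hnN.le
      have h3 : birkhoffSum f (E.indicator (1 : Ω → ℝ)) n x / N ≤ 1 := by
        rw [div_le_one hN0]; linarith
      have h4 : (n : ℝ) * M ≤ N * M := mul_le_mul_of_nonneg_right hn hM0
      linarith
    -- Cut at the first return `j ≥ N`. No visit occurs in `[N, j)`, so there are at most `N` visits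
    -- before `j`, and the drop by `1` pays for them.
    · have hex : ∃ j, N ≤ j ∧ f^[j] x ∈ E := ⟨n, hnN, hnx⟩
      set j := Nat.find hex with hj
      obtain ⟨hNj, hjE⟩ := Nat.find_spec hex
      have hjn : j ≤ n := Nat.find_min' hex ⟨hnN, hnx⟩
      have hvis : birkhoffSum f (E.indicator (1 : Ω → ℝ)) j x ≤ N := by
        obtain ⟨d, hd⟩ := Nat.exists_eq_add_of_le hNj
        rw [← hj] at hd
        rw [hd, birkhoffSum_add]
        have h5 : birkhoffSum f (E.indicator (1 : Ω → ℝ)) d (f^[N] x) = 0 := by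
          refine Finset.sum_eq_zero fun i hi => ?_
          refine indicator_of_notMem (fun hmem => ?_) _
          rw [← Function.iterate_add_apply] at hmem
          have hi' := Finset.mem_range.1 hi
          exact Nat.find_min hex (m := i + N) (by omega) ⟨by omega, hmem⟩
        have h6 := (abs_le.1 (abs_birkhoffSum_le f hind N x)).2
        rw [h5]
        linarith
      have hlt : n - j < n := by omega
      have hsplit : n = j + (n - j) := by omega
      have h7 := ih (n - j) hlt (f^[j] x) hjE (by
        rw [← Function.iterate_add_apply, Nat.sub_add_cancel hjn]; exact hnx)
      have h8 := hE x hx j hNj hjE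
      have h9 : birkhoffSum f g n x = birkhoffSum f g j x + birkhoffSum f g (n - j) (f^[j] x) := by
        conv_lhs => rw [hsplit, birkhoffSum_add]
      have h10 : birkhoffSum f (E.indicator (1 : Ω → ℝ)) n x =
          birkhoffSum f (E.indicator (1 : Ω → ℝ)) j x +
          birkhoffSum f (E.indicator (1 : Ω → ℝ)) (n - j) (f^[j] x) := by
        conv_lhs => rw [hsplit, birkhoffSum_add]
      have h11 : birkhoffSum f (E.indicator (1 : Ω → ℝ)) j x / N ≤ 1 := by
        rw [div_le_one hN0]; exact hvis
      rw [h9, h10, add_div]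
      linarith

theorem measureReal_le_div_of_integral_abs [IsProbabilityMeasure μ] {h : Ω → ℝ}
    (hh : Integrable h μ) {ε : ℝ} (hε : 0 < ε) :
    μ.real {x | ε ≤ |h x|} ≤ (∫ x, |h x| ∂μ) / ε := by
  rw [le_div_iff₀' hε]
  exact mul_meas_ge_le_integral_of_nonneg (Eventually.of_forall fun x => abs_nonneg _) hh.abs ε

/-- A set whose returns after time `N` all have Birkhoff sums at most `-1` is null, when the
observable has mean zero. -/
theorem Ergodic.measure_eq_zero_of_birkhoffSum_le [IsProbabilityMeasure μ] (hf : Ergodic f μ)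
    {g : Ω → ℝ} (hg : Measurable g) {M : ℝ} (hM : ∀ x, |g x| ≤ M) (hg0 : ∫ x, g x ∂μ = 0)
    {E : Set Ω} (hEm : MeasurableSet E) {N : ℕ}
    (hE : ∀ x ∈ E, ∀ n, N ≤ n → f^[n] x ∈ E → birkhoffSum f g n x ≤ -1) : μ E = 0 := by
  wlog hN : 1 ≤ N generalizing N
  · exact this (N := N + 1) (fun x hx n hn => hE x hx n (by omega)) (by omega)
  by_contra hne
  set e := μ.real E with he
  have he0 : 0 < e := ENNReal.toReal_pos hne (measure_ne_top _ _)
  have hN0 : (0 : ℝ) < N := by exact_mod_cast hN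
  set v : Ω → ℝ := E.indicator 1 with hv
  have hvm : Measurable v := measurable_one.indicator hEm
  have hv1 : ∀ x, |v x| ≤ 1 := by
    intro x
    by_cases hx : x ∈ E <;> simp [hv, hx]
  have hvint : ∫ x, v x ∂μ = e := integral_indicator_one hEm
  have hgL : MemLp g 2 μ := MemLp.of_bound hg.aestronglyMeasurable M (Eventually.of_forall hM)
  have hvL : MemLp v 2 μ := MemLp.of_bound hvm.aestronglyMeasurable 1 (Eventually.of_forall hv1)
  have hfm : ∀ i, Measurable f^[i] := fun i => (hf.toMeasurePreserving.iterate i).measurable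
  have havm : ∀ {u : Ω → ℝ}, Measurable u → ∀ n, Measurable (birkhoffAverage ℝ f u n) := by
    intro u hu n
    exact (Finset.measurable_fun_sum _ fun i _ => hu.comp (hfm i)).const_smul (n : ℝ)⁻¹
  have havb : ∀ {u : Ω → ℝ} {K : ℝ}, (∀ x, |u x| ≤ K) → ∀ n x, |birkhoffAverage ℝ f u n x| ≤ K := by
    intro u K hu n x
    have hK : 0 ≤ K := (abs_nonneg _).trans (hu x)
    rcases Nat.eq_zero_or_pos n with rfl | hn
    · simpa using hK
    · have hn' : (0 : ℝ) < n := by exact_mod_cast hn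
      rw [birkhoffAverage, smul_eq_mul, abs_mul, abs_inv, abs_of_pos hn', inv_mul_le_iff₀ hn']
      exact abs_birkhoffSum_le f hu n x
  have havi : ∀ {u : Ω → ℝ} {K : ℝ}, Measurable u → (∀ x, |u x| ≤ K) → ∀ n,
      Integrable (birkhoffAverage ℝ f u n) μ := fun hu hK n =>
    Integrable.of_bound (havm hu n).aestronglyMeasurable _ (Eventually.of_forall (havb hK n))
  have hlimg := hf.tendsto_integral_abs_birkhoffAverage_sub hgL
  have hlimv := hf.tendsto_integral_abs_birkhoffAverage_sub hvL
  rw [hg0] at hlimg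
  rw [hvint] at hlimv
  simp only [sub_zero] at hlimg
  -- A return at a large time `n` forces a deviation: either the visit frequency is at most `e / 2`,
  -- or the average of `g` is below `-e / (2N) + (N M + 1) / n < -e / (4N)`. Both events have
  -- measure tending to `0`.
  have hrare : Tendsto (fun n => μ.real (E ∩ f^[n] ⁻¹' E)) atTop (𝓝 0) := by
    have h1 : ∀ᶠ n : ℕ in atTop, μ.real (E ∩ f^[n] ⁻¹' E) ≤
        (∫ x, |birkhoffAverage ℝ f v n x - e| ∂μ) / (e / 2) +
        (∫ x, |birkhoffAverage ℝ f g n x| ∂μ) / (e / (4 * N)) := by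
      have hlarge : ∀ᶠ n : ℕ in atTop, (N * M + 1) / (e / (4 * N)) < n :=
        tendsto_natCast_atTop_atTop.eventually_gt_atTop _
      filter_upwards [hlarge, eventually_gt_atTop 0] with n hn hn0
      have hn' : (0 : ℝ) < n := by exact_mod_cast hn0
      refine le_trans ?_ (add_le_add
        (measureReal_le_div_of_integral_abs ((havi hvm hv1 n).sub (integrable_const e))
          (half_pos he0))
        (measureReal_le_div_of_integral_abs (havi hg hM n) (by positivity)))
      refine (measureReal_mono ?_).trans (measureReal_union_le _ _)
      rintro x ⟨hx, hnx⟩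
      by_contra hcon
      simp only [mem_union, mem_ofPred_eq, not_or, not_le, Pi.sub_apply] at hcon
      obtain ⟨h2, h3⟩ := hcon
      have h4 := birkhoffSum_le_sub_visits_div f hM hN hE n x hx hnx
      have h5 : birkhoffSum f g n x = n * birkhoffAverage ℝ f g n x := by
        rw [birkhoffAverage, smul_eq_mul, mul_inv_cancel_left₀ hn'.ne']
      have h6 : birkhoffSum f v n x = n * birkhoffAverage ℝ f v n x := by
        rw [birkhoffAverage, smul_eq_mul, mul_inv_cancel_left₀ hn'.ne']
      rw [← hv, h5, h6] at h4
      rw [div_lt_iff₀ (by positivity)] at hn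
      have h7 := (abs_lt.1 h2).1
      have h8 := (abs_lt.1 h3).1
      have h9 : (n : ℝ) * (e / 2) / N ≤ n * birkhoffAverage ℝ f v n x / N := by
        gcongr; linarith
      have h10 : (n : ℝ) * (-(e / (4 * N))) < n * birkhoffAverage ℝ f g n x :=
        mul_lt_mul_of_pos_left h8 hn'
      have h11 : (n : ℝ) * (e / 2) / N = 2 * (n * (e / (4 * N))) := by
        field_simp; ring
      nlinarith
    refine squeeze_zero' (Eventually.of_forall fun n => measureReal_nonneg) h1 ?_
    simpa using (hlimv.div_const (e / 2)).add (hlimg.div_const (e / (4 * N)))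
  -- The Cesàro means of `μ (E ∩ f^{-n} E)` tend to `0`, but by the mean ergodic theorem also to `e
  -- * e`.
  have hces := hrare.cesaro
  have hlim2 : Tendsto (fun n => ∫ x in E, birkhoffAverage ℝ f v n x ∂μ) atTop (𝓝 (e * e)) := by
    rw [tendsto_iff_norm_sub_tendsto_zero]
    refine squeeze_zero (fun n => norm_nonneg _) (fun n => ?_) hlimv
    have h1 : (∫ x in E, birkhoffAverage ℝ f v n x ∂μ) - e * e =
        ∫ x in E, (birkhoffAverage ℝ f v n x - e) ∂μ := by
      rw [integral_sub (havi hvm hv1 n).integrableOn (integrable_const e)]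
      simp [he]
    rw [h1]
    refine (norm_integral_le_integral_norm _).trans ?_
    exact setIntegral_le_integral (((havi hvm hv1 n).sub (integrable_const e)).norm)
      (Eventually.of_forall fun x => norm_nonneg _)
  have heq : ∀ n : ℕ, ∫ x in E, birkhoffAverage ℝ f v n x ∂μ =
      (n⁻¹ : ℝ) * ∑ i ∈ Finset.range n, μ.real (E ∩ f^[i] ⁻¹' E) := by
    intro n
    simp only [birkhoffAverage, birkhoffSum]
    rw [integral_smul, integral_finsetSum, smul_eq_mul]
    · congr 1
      refine Finset.sum_congr rfl fun i _ => ?_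
      have h1 : (fun x => v (f^[i] x)) = (f^[i] ⁻¹' E).indicator (1 : Ω → ℝ) := by
        funext x
        by_cases hx : f^[i] x ∈ E
        · rw [indicator_of_mem (show x ∈ f^[i] ⁻¹' E from hx), hv, indicator_of_mem hx]; rfl
        · rw [indicator_of_notMem (show x ∉ f^[i] ⁻¹' E from hx), hv, indicator_of_notMem hx]
      rw [h1, integral_indicator_one (hfm i hEm),
        measureReal_restrict_apply (hfm i hEm), inter_comm]
    · intro i _
      exact (Integrable.of_bound (hvm.comp (hfm i)).aestronglyMeasurable 1
        (Eventually.of_forall fun x => hv1 _)).integrableOn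
  simp only [heq] at hlim2
  have := tendsto_nhds_unique hlim2 hces
  nlinarith

/-- Almost every point of `A` returns to `A` infinitely often with a Birkhoff sum that is, up to a
bounded error, at least its expected value. -/
theorem Ergodic.ae_frequently_birkhoffSum_ge [IsProbabilityMeasure μ] (hf : Ergodic f μ)
    {g : Ω → ℝ} (hg : Measurable g) {M : ℝ} (hM : ∀ x, |g x| ≤ M)
    {A : Set Ω} (hA : MeasurableSet A) :
    ∀ᵐ x ∂μ, x ∈ A → ∃ᶠ n in atTop, f^[n] x ∈ A ∧
      n * (∫ y, g y ∂μ) - 1 ≤ birkhoffSum f g n x := by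
  set c := ∫ y, g y ∂μ with hc
  set ψ : Ω → ℝ := fun x => g x - c with hψ
  have hψm : Measurable ψ := hg.sub_const c
  have hψM : ∀ x, |ψ x| ≤ M + |c| := fun x => (abs_sub _ _).trans (by linarith [hM x])
  have hgi : Integrable g μ := Integrable.of_bound hg.aestronglyMeasurable M (Eventually.of_forall hM)
  have hψ0 : ∫ x, ψ x ∂μ = 0 := by
    rw [hψ, integral_sub hgi (integrable_const c)]
    simp [hc]
  have hsum : ∀ n x, birkhoffSum f ψ n x = birkhoffSum f g n x - n * c := by
    intro n x
    simp [birkhoffSum, hψ]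
  have hfm : ∀ i, Measurable f^[i] := fun i => (hf.toMeasurePreserving.iterate i).measurable
  have hbm : ∀ n, Measurable (birkhoffSum f ψ n) := fun n =>
    Finset.measurable_fun_sum _ fun i _ => hψm.comp (hfm i)
  -- The points of `A` without a good return after time `N`. A return to `E N` is a return to `A`,
  -- so the previous theorem applies.
  set E : ℕ → Set Ω := fun N =>
    A ∩ ⋂ n, {x | N ≤ n → f^[n] x ∈ A → birkhoffSum f ψ n x ≤ -1} with hE
  have hnull : ∀ N, μ (E N) = 0 := by
    intro N
    refine hf.measure_eq_zero_of_birkhoffSum_le hψm hψM hψ0 (N := N) ?_ ?_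
    · refine hA.inter (MeasurableSet.iInter fun n => ?_)
      by_cases hn : N ≤ n
      · have : {x | N ≤ n → f^[n] x ∈ A → birkhoffSum f ψ n x ≤ -1} =
            (f^[n] ⁻¹' A)ᶜ ∪ {x | birkhoffSum f ψ n x ≤ -1} := by
          ext x
          simp [hn, imp_iff_not_or]
        rw [this]
        exact (hfm n hA).compl.union (measurableSet_le (hbm n) measurable_const)
      · simp [hn]
    · intro x hx n hn hnx
      exact mem_iInter.1 hx.2 n hn hnx.1
  have hall : ∀ᵐ x ∂μ, ∀ N, x ∉ E N := ae_all_iff.2 fun N => measure_eq_zero_iff_ae_notMem.1 (hnull N)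
  filter_upwards [hall] with x hx hxA
  rw [frequently_atTop]
  intro N
  by_contra hcon
  push Not at hcon
  refine hx N ⟨hxA, mem_iInter.2 fun n hn hnA => ?_⟩
  have := hcon n hn hnA
  rw [hsum]
  linarith

/-- An ergodic invariant probability measure that is not supported on a periodic orbit has no
atoms. -/
theorem Ergodic.measure_singleton_eq_zero {X : Type*} [MetricSpace X] [MeasurableSpace X]
    [BorelSpace X] {f : X → X} {ν : Measure X} [IsProbabilityMeasure ν] (hf : Ergodic f ν)
    (hper : ¬ SupportedOnPeriodicOrbit f ν) (x : X) : ν {x} = 0 := by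
  by_contra hne
  -- Poincaré recurrence makes an atom periodic. Its orbit is forward invariant of positive measure,
  -- hence of full measure.
  obtain ⟨y, hy, m, hm, hmy⟩ := hf.toMeasurePreserving.conservative.exists_mem_iterate_mem
    (MeasurableSet.singleton x).nullMeasurableSet hne
  rw [mem_singleton_iff] at hy hmy
  subst hy
  have hp : y ∈ Function.periodicPts f := ⟨m, Nat.pos_of_ne_zero hm, hmy⟩
  refine hper ⟨y, hp, ?_⟩
  set O := range fun k : ℕ => f^[k] y with hO
  have hOm : MeasurableSet O := (countable_range _).measurableSet
  have hsub : O ⊆ f ⁻¹' O := by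
    rintro _ ⟨k, rfl⟩
    exact ⟨k + 1, Function.iterate_succ_apply' f k y⟩
  rcases hf.ae_empty_or_univ_of_ae_le_preimage hOm.nullMeasurableSet
    (LE.le.eventuallyLE hsub) with h | h
  · exfalso
    have hy : y ∈ O := ⟨0, rfl⟩
    exact hne (measure_mono_null (singleton_subset_iff.2 hy) (ae_eq_empty.1 h))
  · exact ae_eq_univ.1 h

end Recurrence

/-! ### Invariance of the Julia set and bounded distortion -/

section JuliaSet

variable {X : Type*} [MetricSpace X] {f : X → X}

theorem isClosed_juliaSet : IsClosed (juliaSet f) :=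
  (isOpen_sUnion fun _ hU => hU.1).isClosed_compl

/-- The Julia set of a continuous map is forward invariant. -/
theorem mapsTo_juliaSet (hf : Continuous f) : MapsTo f (juliaSet f) (juliaSet f) := by
  intro x hx hfx
  refine hx ?_
  obtain ⟨U, ⟨hUo, hUn⟩, hxU⟩ := hfx
  refine ⟨f ⁻¹' U, ⟨hUo.preimage hf, fun s => ?_⟩, hxU⟩
  -- The iterate `f^0` does not factor through `f`. If it recurs in the sequence, the identity is a
  -- limit; otherwise write `f^s = f^{s-1} ∘ f` and use normality on `U`.
  by_cases h0 : ∃ᶠ k in atTop, s k = 0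
  · obtain ⟨θ, hθ, hs⟩ := extraction_of_frequently_atTop h0
    refine ⟨θ, hθ, _root_.id, fun u hu y _ => ⟨univ, univ_mem, ?_⟩⟩
    refine Eventually.of_forall fun k z _ => ?_
    simp only [hs k]
    exact refl_mem_uniformity hu
  · rw [not_frequently] at h0
    obtain ⟨θ, hθ, hs⟩ := extraction_of_eventually_atTop h0
    obtain ⟨η, hη, g, hg⟩ := hUn fun k => s (θ k) - 1
    refine ⟨θ ∘ η, hθ.comp hη, g ∘ f, ?_⟩
    have h1 := hg.comp f (mapsTo_preimage f U) hf.continuousOn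
    have h2 : (fun k => f^[s ((θ ∘ η) k)]) = fun k => f^[s (θ (η k)) - 1] ∘ f := by
      funext k
      rw [← Function.iterate_succ]
      congr 1
      have := hs (η k)
      simp only [Function.comp_apply]
      omega
    rw [h2]
    exact h1

variable [CompactSpace X]

/-- A connected set lies in a single component. Compactness makes that component bounded, so that
`Metric.diam` is not its default value `0`. -/
theorem dist_le_of_isPreconnected_subset_preimage {x : X} {ρ r : ℝ} {n : ℕ}
    (h : ∀ W, IsPullBack f n (Metric.ball x ρ) W → Metric.diam W ≤ r) {V : Set X}
    (hV : IsPreconnected V) (hVs : V ⊆ f^[n] ⁻¹' Metric.ball x ρ) {y z : X} (hy : y ∈ V)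
    (hz : z ∈ V) : dist y z ≤ r := by
  refine le_trans ?_ (h _ ⟨y, hVs hy, rfl⟩)
  exact Metric.dist_le_diam_of_mem (isCompact_univ.isBounded.subset (subset_univ _))
    (mem_connectedComponentIn (hVs hy)) (hV.subset_connectedComponentIn hy hVs hz)

/-- Birkhoff sums of Hölder functions have bounded distortion on pull-backs, for maps with
sufficiently fast polynomial shrinking. -/
theorem exists_abs_birkhoffSum_sub_le (hf : Continuous f) {α : ℝ≥0} {β ρ C₀ : ℝ}
    (hαβ : 1 < β * α) (hC₀ : 0 ≤ C₀)
    (hP : ∀ x ∈ juliaSet f, ∀ n : ℕ, 1 ≤ n → ∀ W : Set X,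
      IsPullBack f n (Metric.ball x ρ) W → Metric.diam W ≤ C₀ * (n : ℝ) ^ (-β))
    {φ : X → ℝ} {C : ℝ≥0} (hφ : HolderOnWith C α φ (juliaSet f)) :
    ∃ D : ℝ, 0 ≤ D ∧ ∀ n : ℕ, ∀ x ∈ juliaSet f, ∀ V : Set X, IsPreconnected V →
      V ⊆ f^[n] ⁻¹' Metric.ball x ρ → ∀ y ∈ V ∩ juliaSet f, ∀ z ∈ V ∩ juliaSet f,
        |birkhoffSum f φ n y - birkhoffSum f φ n z| ≤ D := by
  set u : ℕ → ℝ := fun j => C * (C₀ * ((j : ℝ)) ^ (-β)) ^ (α : ℝ) with hu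
  have hu0 : ∀ j, 0 ≤ u j := fun j => by positivity
  have hus : Summable u := by
    have h1 : u = fun j : ℕ => C * C₀ ^ (α : ℝ) * (j : ℝ) ^ (-(β * α)) := by
      funext j
      rw [hu]
      simp only
      rw [Real.mul_rpow hC₀ (by positivity), ← Real.rpow_mul (by positivity), mul_assoc, neg_mul]
    rw [h1]
    exact (Real.summable_nat_rpow.2 (by linarith)).mul_left _
  refine ⟨∑' j, u j, tsum_nonneg hu0, fun n x hx V hV hVs y hy z hz => ?_⟩
  -- `f^i(V)` is connected and lies in a preimage under `f^{n-i}`, with `n - i ≥ 1`, so shrinking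
  -- applies with that exponent.
  have hterm : ∀ i ∈ Finset.range n, |φ (f^[i] y) - φ (f^[i] z)| ≤ u (n - i) := by
    intro i hi
    have hin := Finset.mem_range.1 hi
    have hd : dist (f^[i] y) (f^[i] z) ≤ C₀ * ((n - i : ℕ) : ℝ) ^ (-β) := by
      refine dist_le_of_isPreconnected_subset_preimage (hP x hx (n - i) (by omega))
        (hV.image f^[i] (hf.iterate i).continuousOn) ?_ (mem_image_of_mem _ hy.1)
        (mem_image_of_mem _ hz.1)
      rintro _ ⟨w, hw, rfl⟩
      have : f^[n - i] (f^[i] w) = f^[n] w := by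
        rw [← Function.iterate_add_apply, Nat.sub_add_cancel hin.le]
      rw [mem_preimage, this]
      exact hVs hw
    rw [← Real.dist_eq]
    exact hφ.dist_le_of_le ((mapsTo_juliaSet hf).iterate i hy.2)
      ((mapsTo_juliaSet hf).iterate i hz.2) hd
  rw [birkhoffSum, birkhoffSum, ← Finset.sum_sub_distrib]
  refine (Finset.abs_sum_le_sum_abs _ _).trans ((Finset.sum_le_sum hterm).trans ?_)
  have h2 : ∑ i ∈ Finset.range n, u (n - i) = ∑ j ∈ (Finset.range n).image (n - ·), u j := by
    rw [Finset.sum_image]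
    intro i hi j hj hij
    have := Finset.mem_range.1 hi
    have := Finset.mem_range.1 hj
    simp only at hij
    omega
  rw [h2]
  exact hus.sum_le_tsum _ fun j _ => hu0 j

end JuliaSet

/-! ### Freeness from disjoint domains -/

namespace IMFS

variable {X : Type*} [MetricSpace X] {f : X → X} {B₀ : Set X} (Φ : IMFS f B₀)

theorem mem_wordBranch_cons {l : ℕ} {w : List ℕ} {x y : X} (hy : y ∈ Φ.wordBranch (l :: w) x) :
    y ∈ Φ.dom l ∧ f^[Φ.time l] y ∈ Φ.wordBranch w x := by
  obtain ⟨z, hz, h1, h2⟩ := mem_iUnion₂.1 hy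
  exact ⟨h1, by rw [h2]; exact hz⟩

theorem wordTime_cons (l : ℕ) (w : List ℕ) : Φ.wordTime (l :: w) = Φ.time l + Φ.wordTime w := by
  simp [wordTime]

/-- An IMFS whose domains are pairwise disjoint is free. -/
theorem isFree_of_pairwise_disjoint (h : Pairwise fun l k => Disjoint (Φ.dom l) (Φ.dom k)) :
    Φ.IsFree := by
  obtain ⟨x, hx⟩ := Φ.isConnected_base.nonempty
  refine ⟨x, hx, fun w w' _ _ hne ht => disjoint_left.2 ?_⟩
  -- A common point lies in the domains of both first letters, so these agree; apply `f^{m_l}` and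
  -- drop them. Neither word can run out first, since the total times agree and each letter takes
  -- time at least `1`.
  have key : ∀ w w' : List ℕ, w ≠ w' → Φ.wordTime w = Φ.wordTime w' →
      ∀ y, y ∈ Φ.wordBranch w x → y ∉ Φ.wordBranch w' x := by
    intro w
    induction w with
    | nil =>
      intro w' hne ht
      cases w' with
      | nil => exact absurd rfl hne
      | cons l w' =>
        have := Φ.one_le_time l
        rw [wordTime_cons] at ht
        simp [wordTime] at ht
        omega
    | cons l w ih =>
      intro w' hne ht y hy hy'
      cases w' with
      | nil =>
        have := Φ.one_le_time l
        rw [wordTime_cons] at ht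
        simp [wordTime] at ht
        omega
      | cons k w' =>
        obtain ⟨h1, h2⟩ := Φ.mem_wordBranch_cons hy
        obtain ⟨h3, h4⟩ := Φ.mem_wordBranch_cons hy'
        by_cases hlk : l = k
        · subst hlk
          rw [wordTime_cons, wordTime_cons] at ht
          exact ih w' (fun hw => hne (by rw [hw])) (by omega) _ h2 h4
        · exact disjoint_left.1 (h hlk) h1 h3
  exact fun y hy => key w w' hne ht y hy

end IMFS

/-! ### Construction of the free system -/

section Existence

variable {X : Type*} [MetricSpace X]

/-- A sequence of sets in annuli around `p`, obtained by repeatedly choosing one in a smaller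
annulus. -/
theorem exists_seq_pairwise_disjoint_of_forall_annulus {ι : Type*} (p : X) (P : ι → Prop)
    (S : ι → Set X)
    (h : ∀ ε > (0 : ℝ), ∃ d > (0 : ℝ), d < ε ∧ ∃ i, P i ∧
      ∀ w ∈ S i, 3 / 4 * d < dist w p ∧ dist w p < 5 / 4 * d) :
    ∃ s : ℕ → ι, (∀ l, P (s l)) ∧ Pairwise fun l k => Disjoint (S (s l)) (S (s k)) := by
  obtain ⟨-, -, -, i₀, -⟩ := h 1 one_pos
  have : Nonempty ι := ⟨i₀⟩
  choose! d hd0 hdε i hPi hi using h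
  -- Shrinking the radius to `d / 4` separates the annuli: the next one has outer radius below `5/16
  -- * d`, less than `3/4 * d`.
  set e : ℕ → ℝ := fun l => Nat.rec 1 (fun _ ε => d ε / 4) l with he
  have hes : ∀ l, e (l + 1) = d (e l) / 4 := fun l => rfl
  have he0 : ∀ l, 0 < e l := by
    intro l
    induction l with
    | zero => exact one_pos
    | succ l ih => rw [hes]; linarith [hd0 _ ih]
  have hanti : Antitone e := antitone_nat_of_succ_le fun l => by
    rw [hes]; linarith [hd0 _ (he0 l), hdε _ (he0 l)]
  refine ⟨fun l => i (e l), fun l => hPi _ (he0 l), ?_⟩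
  have key : ∀ l k, l < k → Disjoint (S (i (e l))) (S (i (e k))) := by
    intro l k hlk
    rw [disjoint_left]
    intro w h1 h2
    have h3 := (hi _ (he0 l) w h1).1
    have h4 := (hi _ (he0 k) w h2).2
    have h5 := hdε _ (he0 k)
    have h6 : e k ≤ d (e l) / 4 := (hanti (Nat.succ_le_of_lt hlk)).trans (hes l).le
    linarith [hd0 _ (he0 l)]
  intro l k hlk
  rcases lt_or_gt_of_ne hlk with h | h
  · exact key l k h
  · exact (key k l h).symm

theorem IsPullBack.isPreconnected {f : X → X} {n : ℕ} {V W : Set X} (h : IsPullBack f n V W) :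
    IsPreconnected W := by
  obtain ⟨x, -, rfl⟩ := h
  exact isPreconnected_connectedComponentIn

theorem IsPullBack.subset_preimage {f : X → X} {n : ℕ} {V W : Set X} (h : IsPullBack f n V W) :
    W ⊆ f^[n] ⁻¹' V := by
  obtain ⟨x, -, rfl⟩ := h
  exact connectedComponentIn_subset _ _

variable [CompactSpace X] [MeasurableSpace X] [BorelSpace X] {f : X → X}

/-- The construction of free iterated multivalued function systems with controlled Birkhoff sums,
from the recurrence of an open set `A`, when base points returning to `A` can be followed by full
pull-backs of `B₀`. -/
theorem exists_isFree_IMFS (hf : Continuous f) {α : ℝ≥0} {β ρ C₀ : ℝ} (hβ : 0 < β)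
    (hαβ : 1 < β * α) (hC₀ : 0 ≤ C₀)
    (hP : ∀ x ∈ juliaSet f, ∀ n : ℕ, 1 ≤ n → ∀ W : Set X,
      IsPullBack f n (Metric.ball x ρ) W → Metric.diam W ≤ C₀ * (n : ℝ) ^ (-β))
    {φ : X → ℝ} {C : ℝ≥0} (hφ : HolderOnWith C α φ (juliaSet f))
    {ν : Measure X} [IsProbabilityMeasure ν] (hνJ : ν (juliaSet f)ᶜ = 0) (hν : Ergodic f ν)
    (hper : ¬ SupportedOnPeriodicOrbit f ν) {x₀ : X} (hx₀ : x₀ ∈ juliaSet f) {B₀ : Set X}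
    (hB₀c : IsCompact B₀) (hB₀ : IsConnected B₀) (hx₀B : x₀ ∈ B₀) (hB₀ρ : B₀ ⊆ Metric.ball x₀ ρ)
    {A : Set X} (hA : IsOpen A) (hAB : A ⊆ B₀) (hνA : ν A ≠ 0) (K N₀ : ℕ)
    (H : ∀ n, N₀ ≤ n → ∀ y ∈ A ∩ juliaSet f, f^[n] y ∈ A → ∃ k ≤ K, ∃ W,
      IsPullBack f (n + k) B₀ W ∧ f^[n + k] '' W = B₀ ∧
      (W ∩ juliaSet f ∩ connectedComponentIn (f^[n] ⁻¹' Metric.ball x₀ ρ) y).Nonempty) :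
    ∃ D > (0 : ℝ), ∃ Φ : IMFS f B₀, Φ.IsFree ∧ ∀ l, ∀ y ∈ Φ.branchImage l B₀ ∩ juliaSet f,
      Φ.time l * (∫ x in juliaSet f, φ x ∂ν) - D ≤ birkhoffSum f φ (Φ.time l) y := by
  classical
  set J := juliaSet f with hJ
  have hJm : MeasurableSet J := isClosed_juliaSet.measurableSet
  have hJf : ∀ i, ∀ y ∈ J, f^[i] y ∈ J := fun i y hy => (mapsTo_juliaSet hf).iterate i hy
  have hα0 : 0 < α := by
    rcases eq_or_lt_of_le (zero_le : 0 ≤ α) with h | h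
    · rw [← h] at hαβ; simp at hαβ; linarith
    · exact h
  have hφc : ContinuousOn φ J := hφ.continuousOn hα0
  -- Extending `φ` by zero gives a bounded measurable observable with the same Birkhoff sums on `J`.
  set g : X → ℝ := J.indicator φ with hg
  have hgm : Measurable g := by
    rw [hg, ← piecewise_eq_indicator]
    exact hφc.measurable_piecewise continuousOn_const hJm
  obtain ⟨M, hM⟩ := isClosed_juliaSet.isCompact.exists_bound_of_continuousOn hφc
  have hM0 : 0 ≤ M := (norm_nonneg _).trans (hM x₀ hx₀)
  have hgM : ∀ x, |g x| ≤ M := by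
    intro x
    by_cases hx : x ∈ J
    · rw [hg, indicator_of_mem hx]; exact hM x hx
    · rw [hg, indicator_of_notMem hx]; simpa using hM0
  have hgφ : ∀ n, ∀ y ∈ J, birkhoffSum f g n y = birkhoffSum f φ n y := fun n y hy =>
    Finset.sum_congr rfl fun i _ => indicator_of_mem (hJf i y hy) φ
  set c := ∫ x in J, φ x ∂ν with hc
  have hgc : ∫ x, g x ∂ν = c := integral_indicator hJm
  obtain ⟨D₁, hD₁0, hD₁⟩ := exists_abs_birkhoffSum_sub_le hf hαβ hC₀ hP hφ
  have hrec := hν.ae_frequently_birkhoffSum_ge hgm hgM hA.measurableSet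
  rw [hgc] at hrec
  have hJae : ∀ᵐ x ∂ν, x ∈ J := mem_ae_iff.2 hνJ
  obtain ⟨p, hpA, hp⟩ := exists_mem_forall_mem_nhdsWithin_pos_measure hνA
  -- One distortion constant for `W`, one for the pull-back `V` around `y`, the `1` from recurrence,
  -- and the cost of at most `K` extra steps.
  set D : ℝ := 2 * D₁ + 1 + K * (M + |c|) with hD
  have hDpos : 0 < D := by positivity
  have hstep : ∀ ε > (0 : ℝ), ∃ d > (0 : ℝ), d < ε ∧ ∃ i : ℕ × Set X,
      (1 ≤ i.1 ∧ IsPullBack f i.1 B₀ i.2 ∧ i.2 ⊆ B₀ ∧ f^[i.1] '' i.2 = B₀ ∧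
        ∀ w ∈ i.2 ∩ J, i.1 * c - D ≤ birkhoffSum f φ i.1 w) ∧
      ∀ w ∈ i.2, 3 / 4 * d < dist w p ∧ dist w p < 5 / 4 * d := by
    intro ε hε
    -- The absence of atoms allows a choice of `y` near `p` but different from it, so that `d > 0`.
    have hpos : ν ((Metric.ball p ε ∩ A) \ {p}) ≠ 0 := by
      rw [measure_sdiff_null (hν.measure_singleton_eq_zero hper p)]
      exact (hp _ (inter_mem (mem_nhdsWithin_of_mem_nhds (Metric.ball_mem_nhds p hε))
        self_mem_nhdsWithin)).ne'
    obtain ⟨y, ⟨⟨hyε, hyA⟩, hyp⟩, hyJ, hyrec⟩ :=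
      ((frequently_ae_mem_iff.2 hpos).and_eventually (hJae.and hrec)).exists
    set d := dist y p with hd
    have hd0 : 0 < d := dist_pos.2 hyp
    refine ⟨d, hd0, hyε, ?_⟩
    obtain ⟨η, hη0, hη⟩ := Metric.isOpen_iff.1 hA y hyA
    -- Distance less than `η` from `y` keeps `W` inside `A ⊆ B₀`; less than `d / 4` puts it in the
    -- annulus.
    have hη' : 0 < min η (d / 4) := lt_min hη0 (by linarith)
    have hlim : Tendsto (fun n : ℕ => 2 * (C₀ * (n : ℝ) ^ (-β))) atTop (𝓝 0) := by
      have := (((tendsto_rpow_neg_atTop hβ).comp tendsto_natCast_atTop_atTop).const_mul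
        C₀).const_mul 2
      simpa using this
    obtain ⟨n, ⟨hnA, hnS⟩, hn1, hnN, hnη⟩ := ((hyrec hyA).and_eventually
      ((eventually_ge_atTop 1).and ((eventually_ge_atTop N₀).and
        (hlim.eventually_lt_const hη')))).exists
    obtain ⟨k, hkK, W, hW, hWim, z, ⟨hzW, hzJ⟩, hzV⟩ := H n hnN y ⟨hyA, hyJ⟩ hnA
    set V := connectedComponentIn (f^[n] ⁻¹' Metric.ball x₀ ρ) y with hV
    have hVp : IsPreconnected V := isPreconnected_connectedComponentIn
    have hVs : V ⊆ f^[n] ⁻¹' Metric.ball x₀ ρ := connectedComponentIn_subset _ _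
    have hyV : y ∈ V := mem_connectedComponentIn (show f^[n] y ∈ _ from hB₀ρ (hAB hnA))
    have hWs : W ⊆ f^[n + k] ⁻¹' Metric.ball x₀ ρ :=
      hW.subset_preimage.trans (preimage_mono hB₀ρ)
    -- `W` and `V` meet at `z` and each has diameter at most `C₀ * n^{-β}`, whence the factor `2` in
    -- `hlim`.
    have hWy : ∀ w ∈ W, dist w y < min η (d / 4) := by
      intro w hw
      have h1 := dist_le_of_isPreconnected_subset_preimage (hP x₀ hx₀ (n + k) (by omega))
        hW.isPreconnected hWs hw hzW
      have h2 := dist_le_of_isPreconnected_subset_preimage (hP x₀ hx₀ n hn1) hVp hVs hzV hyV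
      have hn0 : (0 : ℝ) < n := by exact_mod_cast hn1
      have h3 : ((n + k : ℕ) : ℝ) ^ (-β) ≤ (n : ℝ) ^ (-β) :=
        Real.rpow_le_rpow_of_nonpos hn0 (by push_cast; linarith [(Nat.cast_nonneg k : (0:ℝ) ≤ k)])
          (by linarith)
      have h4 := mul_le_mul_of_nonneg_left h3 hC₀
      linarith [dist_triangle w z y]
    refine ⟨(n + k, W), ⟨by dsimp only; omega, hW, ?_, hWim, ?_⟩, ?_⟩
    · exact fun w hw => hAB (hη ((hWy w hw).trans_le (min_le_left _ _)))
    · rintro w ⟨hwW, hwJ⟩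
      have h1 := abs_le.1 (hD₁ (n + k) x₀ hx₀ W hW.isPreconnected hWs w ⟨hwW, hwJ⟩ z ⟨hzW, hzJ⟩)
      have h2 := abs_le.1 (hD₁ n x₀ hx₀ V hVp hVs z ⟨hzV, hzJ⟩ y ⟨hyV, hyJ⟩)
      have h3 := abs_le.1 (abs_birkhoffSum_le f hgM k (f^[n] z))
      rw [hgφ k _ (hJf n z hzJ)] at h3
      rw [hgφ n y hyJ] at hnS
      have h4 := birkhoffSum_add f φ n k z
      have hkK' : (k : ℝ) ≤ K := by exact_mod_cast hkK
      have h5 : (k : ℝ) * (M + |c|) ≤ K * (M + |c|) :=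
        mul_le_mul_of_nonneg_right hkK' (by positivity)
      have h6 : (k : ℝ) * c ≤ k * |c| :=
        mul_le_mul_of_nonneg_left (le_abs_self c) (Nat.cast_nonneg k)
      dsimp only
      push_cast
      linarith [h1.1, h2.1, h3.1]
    · intro w hw
      have h1 := (hWy w hw).trans_le (min_le_right _ _)
      have h2 := dist_triangle w y p
      have h3 := dist_triangle_left y p w
      rw [← hd] at h2 h3
      exact ⟨by linarith, by linarith⟩
  obtain ⟨s, hs, hdisj⟩ := exists_seq_pairwise_disjoint_of_forall_annulus p _ _ hstep
  refine ⟨D, hDpos, ⟨hB₀c, hB₀, ⟨x₀, hx₀B, hx₀⟩, fun l => (s l).1, fun l => (s l).2,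
    fun l => (hs l).1, fun l => (hs l).2.1, fun l => (hs l).2.2.1, fun l => (hs l).2.2.2.1⟩,
    IMFS.isFree_of_pairwise_disjoint _ hdisj, ?_⟩
  rintro l y ⟨hy, hyJ⟩
  obtain ⟨x, hx, hyW, -⟩ := mem_iUnion₂.1 hy
  exact (hs l).2.2.2.2 y ⟨hyW, hyJ⟩

end Existence

/-! ### Points of the support -/

section Support

theorem ae_forall_mem_nhds_measure_pos {X : Type*} [TopologicalSpace X]
    [SecondCountableTopology X] [MeasurableSpace X] (ν : Measure X) :
    ∀ᵐ x ∂ν, ∀ t ∈ 𝓝 x, 0 < ν t := by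
  rw [ae_iff]
  by_contra hne
  obtain ⟨x, hx, h⟩ := exists_mem_forall_mem_nhdsWithin_pos_measure hne
  exact hx fun t ht => h t (mem_nhdsWithin_of_mem_nhds ht)

theorem infinite_setOf_forall_mem_nhds_measure_pos {X : Type*} [TopologicalSpace X]
    [SecondCountableTopology X] [MeasurableSpace X] {ν : Measure X}
    (hν : ∀ x, ν {x} = 0) {E : Set X} (hE : ν E ≠ 0) :
    {x | x ∈ E ∧ ∀ t ∈ 𝓝 x, 0 < ν t}.Infinite := by
  intro hfin
  have : NullSingletonClass ν := ⟨hν⟩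
  have h0 : ν (E \ {x | x ∈ E ∧ ∀ t ∈ 𝓝 x, 0 < ν t}) ≠ 0 := by
    rwa [measure_sdiff_null (hfin.measure_zero ν)]
  obtain ⟨x, hx, h⟩ := exists_mem_forall_mem_nhdsWithin_pos_measure h0
  exact hx.2 ⟨hx.1, fun t ht => h t (mem_nhdsWithin_of_mem_nhds ht)⟩

end Support

/-! ### Consequences of the intermediate value theorem -/

section RealFunctions

/-- A continuous function that takes the values `c` and `d` on an interval maps some subinterval
onto `[c, d]`. -/
theorem exists_image_uIcc_eq_Icc {G : ℝ → ℝ} (hG : Continuous G) {c d : ℝ} (hcd : c ≤ d)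
    {u v s₀ t₀ : ℝ} (hs₀ : s₀ ∈ uIcc u v) (ht₀ : t₀ ∈ uIcc u v) (hGs : G s₀ = c) (hGt : G t₀ = d) :
    ∃ s ∈ uIcc u v, ∃ t ∈ uIcc u v, G '' uIcc s t = Icc c d := by
  -- Take a closest pair `s`, `t` with `G s = c` and `G t = d`. If `G` left `[c, d]` between them,
  -- the intermediate value theorem would give a closer pair.
  set P : Set (ℝ × ℝ) := (uIcc u v ×ˢ uIcc u v) ∩ {q | G q.1 = c ∧ G q.2 = d} with hP
  have hPc : IsCompact P := by
    refine (isCompact_uIcc.prod isCompact_uIcc).inter_right ?_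
    exact (isClosed_eq (hG.comp continuous_fst) continuous_const).inter
      (isClosed_eq (hG.comp continuous_snd) continuous_const)
  obtain ⟨⟨s, t⟩, ⟨⟨hs, ht⟩, hsc, htd⟩, hmin⟩ := hPc.exists_isMinOn (f := fun q => |q.1 - q.2|)
    ⟨(s₀, t₀), ⟨hs₀, ht₀⟩, hGs, hGt⟩ (by fun_prop)
  simp only at hs ht hsc htd
  refine ⟨s, hs, t, ht, Subset.antisymm ?_ ?_⟩
  · rintro _ ⟨w, hw, rfl⟩
    have hwuv : w ∈ uIcc u v := uIcc_subset_uIcc hs ht hw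
    constructor
    · by_contra! hlt
      have h1 : c ∈ uIcc (G w) (G t) := mem_uIcc_of_le hlt.le (by rw [htd]; exact hcd)
      obtain ⟨x, hx, hGx⟩ := intermediate_value_uIcc hG.continuousOn h1
      have h2 := hmin (show (x, t) ∈ P from ⟨⟨uIcc_subset_uIcc hwuv ht hx, ht⟩, hGx, htd⟩)
      simp only [mem_ofPred_eq] at h2
      have hxs : x ≠ w := by rintro rfl; linarith
      have hws : w ≠ s := by rintro rfl; linarith
      rcases mem_uIcc.1 hw with h | h <;> rcases mem_uIcc.1 hx with h' | h' <;>
        rcases lt_or_gt_of_ne hxs with h3 | h3 <;> rcases lt_or_gt_of_ne hws with h4 | h4 <;>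
        cases abs_cases (s - t) <;> cases abs_cases (x - t) <;> linarith
    · by_contra! hlt
      have h1 : d ∈ uIcc (G s) (G w) := mem_uIcc_of_le (by rw [hsc]; exact hcd) hlt.le
      obtain ⟨x, hx, hGx⟩ := intermediate_value_uIcc hG.continuousOn h1
      have h2 := hmin (show (s, x) ∈ P from ⟨⟨hs, uIcc_subset_uIcc hs hwuv hx⟩, hsc, hGx⟩)
      simp only [mem_ofPred_eq] at h2
      have hxs : x ≠ w := by rintro rfl; linarith
      have hwt : w ≠ t := by rintro rfl; linarith
      rcases mem_uIcc.1 hw with h | h <;> rcases mem_uIcc.1 hx with h' | h' <;>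
        rcases lt_or_gt_of_ne hxs with h3 | h3 <;> rcases lt_or_gt_of_ne hwt with h4 | h4 <;>
        cases abs_cases (s - t) <;> cases abs_cases (s - x) <;> linarith
  · have := intermediate_value_uIcc (hG.continuousOn (s := uIcc s t))
    rwa [hsc, htd, uIcc_of_le hcd] at this

/-- A continuous function that leaves `(c, d)` on an interval reaches an endpoint of `[c, d]`
before leaving `[c, d]`. -/
theorem exists_image_uIcc_subset_Icc {G : ℝ → ℝ} (hG : Continuous G) {c d y u : ℝ}
    (hy : G y ∈ Icc c d) (hu : G u ∉ Ioo c d) :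
    ∃ v ∈ uIcc y u, G '' uIcc y v ⊆ Icc c d ∧ (G v = c ∨ G v = d) := by
  have hPc : IsCompact (uIcc y u ∩ G ⁻¹' (Ioo c d)ᶜ) :=
    isCompact_uIcc.inter_right (isOpen_Ioo.isClosed_compl.preimage hG)
  -- `v` is the point nearest to `y` where `G` is outside `(c, d)`; by continuity `G v` is an
  -- endpoint.
  obtain ⟨v, ⟨hv, hGv⟩, hmin⟩ := hPc.exists_isMinOn (f := fun w => |w - y|)
    ⟨u, right_mem_uIcc, hu⟩ (by fun_prop)
  have key : ∀ w ∈ uIcc y v, w ≠ v → G w ∈ Ioo c d := by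
    intro w hw hwv
    by_contra hcon
    have h2 := hmin (show w ∈ uIcc y u ∩ G ⁻¹' (Ioo c d)ᶜ from
      ⟨uIcc_subset_uIcc left_mem_uIcc hv hw, hcon⟩)
    simp only [mem_ofPred_eq] at h2
    rcases mem_uIcc.1 hw with h | h <;> rcases lt_or_gt_of_ne hwv with h4 | h4 <;>
      cases abs_cases (v - y) <;> cases abs_cases (w - y) <;> linarith
  have hv1 : c ≤ G v := by
    by_contra! hlt
    obtain ⟨x, hx, hGx⟩ := intermediate_value_uIcc (hG.continuousOn (s := uIcc v y))
      (mem_uIcc_of_le hlt.le hy.1)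
    rw [uIcc_comm] at hx
    have := key x hx (by rintro rfl; linarith)
    exact absurd this.1 (by rw [hGx]; exact lt_irrefl _)
  have hv2 : G v ≤ d := by
    by_contra! hlt
    obtain ⟨x, hx, hGx⟩ := intermediate_value_uIcc (hG.continuousOn (s := uIcc y v))
      (mem_uIcc_of_le hy.2 hlt.le)
    have := key x hx (by rintro rfl; linarith)
    exact absurd this.2 (by rw [hGx]; exact lt_irrefl _)
  refine ⟨v, hv, ?_, ?_⟩
  · rintro _ ⟨w, hw, rfl⟩
    by_cases hwv : w = v
    · rw [hwv]; exact ⟨hv1, hv2⟩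
    · exact Ioo_subset_Icc_self (key w hw hwv)
  · by_contra! hcon
    exact hGv ⟨lt_of_le_of_ne hv1 (Ne.symm hcon.1), lt_of_le_of_ne hv2 hcon.2⟩

end RealFunctions

theorem exists_isPullBack_image_eq {X : Type*} [MetricSpace X] {f : X → X} {n : ℕ} {B S : Set X}
    (hS : IsPreconnected S) (hne : S.Nonempty) (him : f^[n] '' S = B) :
    ∃ W, S ⊆ W ∧ IsPullBack f n B W ∧ f^[n] '' W = B := by
  obtain ⟨x, hx⟩ := hne
  have hsub : S ⊆ f^[n] ⁻¹' B := image_subset_iff.1 him.subset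
  have hSW := hS.subset_connectedComponentIn hx hsub
  exact ⟨_, hSW, ⟨x, hsub hx, rfl⟩, Subset.antisymm
    (image_subset_iff.2 (connectedComponentIn_subset _ _)) (him.symm.subset.trans (image_mono hSW))⟩

/-! ### The real case -/

section Interval

variable {a b : ℝ}

theorem IsC3NonFlat.continuous {hab : a ≤ b} {f : Icc a b → Icc a b} (hf : IsC3NonFlat hab f) :
    Continuous f := by
  rw [continuous_induced_rng]
  have h := continuousOn_iff_continuous_domRestrict.1 hf.differentiable.continuousOn
  convert! h using 1
  funext x
  exact (IccExtend_val hab (fun x => (f x : ℝ)) x).symm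

/-- If an interval on which `f^n` is a map to `[c, d]` covers under `f^n` a set that `f^k` maps
over the Julia set, and `[c, d]` lies between two points of the Julia set, then the interval meets
a pull-back of `[c, d]` that is mapped onto it. -/
theorem exists_isPullBack_of_covers_julia (hab : a ≤ b) {f : Icc a b → Icc a b}
    (hf : Continuous f) {J : Set (Icc a b)} (hJ : f ⁻¹' J = J) {c d : ℝ} (hcd : c ≤ d)
    {j₁ j₂ : Icc a b} (hj₁ : j₁ ∈ J) (hj₂ : j₂ ∈ J) (hc : (j₁ : ℝ) ≤ c) (hd : d ≤ (j₂ : ℝ))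
    {x₀ : Icc a b} (hx₀J : x₀ ∈ J) (hx₀ : (x₀ : ℝ) ∈ Icc c d) {y v : ℝ} {n k : ℕ}
    {U : Set (Icc a b)} (hU : f^[k] '' (U ∩ J) = J)
    (hcov : ∀ x ∈ U, ∃ w ∈ uIcc y v, f^[n] (projIcc a b hab w) = x) :
    ∃ W, IsPullBack f (n + k) ((↑) ⁻¹' Icc c d) W ∧ f^[n + k] '' W = (↑) ⁻¹' Icc c d ∧
      (W ∩ J ∩ projIcc a b hab '' uIcc y v).Nonempty := by
  set G : ℝ → ℝ := fun t => (f^[n + k] (projIcc a b hab t) : ℝ) with hG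
  have hGc : Continuous G :=
    continuous_subtype_val.comp ((hf.iterate _).comp continuous_projIcc)
  -- In particular `G` takes the values `j₁` and `j₂` on the interval, hence every value in `[c,
  -- d]`.
  have hcovJ : ∀ x ∈ J, ∃ w ∈ uIcc y v, G w = x := by
    intro x hx
    rw [← hU] at hx
    obtain ⟨z, ⟨hzU, -⟩, rfl⟩ := hx
    obtain ⟨w, hw, rfl⟩ := hcov z hzU
    refine ⟨w, hw, ?_⟩
    simp only [hG]
    rw [add_comm, Function.iterate_add_apply]
  obtain ⟨w₁, hw₁, hG₁⟩ := hcovJ j₁ hj₁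
  obtain ⟨w₂, hw₂, hG₂⟩ := hcovJ j₂ hj₂
  have hval : ∀ e ∈ Icc c d, ∃ s ∈ uIcc y v, G s = e := by
    intro e he
    obtain ⟨s, hs, hGs⟩ := intermediate_value_uIcc (hGc.continuousOn (s := uIcc w₁ w₂))
      (mem_uIcc_of_le (show G w₁ ≤ e by rw [hG₁]; exact hc.trans he.1)
        (show e ≤ G w₂ by rw [hG₂]; exact he.2.trans hd))
    exact ⟨s, uIcc_subset_uIcc hw₁ hw₂ hs, hGs⟩
  obtain ⟨s₀, hs₀, hGs₀⟩ := hval c (left_mem_Icc.2 hcd)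
  obtain ⟨t₀, ht₀, hGt₀⟩ := hval d (right_mem_Icc.2 hcd)
  obtain ⟨s, hs, t, ht, him⟩ := exists_image_uIcc_eq_Icc hGc hcd hs₀ ht₀ hGs₀ hGt₀
  have him' : f^[n + k] '' (projIcc a b hab '' uIcc s t) = (↑) ⁻¹' Icc c d := by
    ext x
    rw [mem_preimage, ← him]
    constructor
    · rintro ⟨_, ⟨w, hw, rfl⟩, rfl⟩
      exact ⟨w, hw, rfl⟩
    · rintro ⟨w, hw, hwx⟩
      exact ⟨_, ⟨w, hw, rfl⟩, Subtype.ext hwx⟩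
  obtain ⟨W, hSW, hW, hWim⟩ := exists_isPullBack_image_eq
    (isPreconnected_uIcc.image _ continuous_projIcc.continuousOn)
    (nonempty_uIcc.image _) him'
  refine ⟨W, hW, hWim, ?_⟩
  obtain ⟨z, hz, hzx⟩ : x₀ ∈ f^[n + k] '' (projIcc a b hab '' uIcc s t) := by
    rw [him']; exact hx₀
  -- Complete invariance puts the preimage `z` of `x₀` in the Julia set.
  refine ⟨z, ⟨hSW hz, ?_⟩, image_mono (uIcc_subset_uIcc hs ht) hz⟩
  have h := Function.IsFixedPt.preimage_iterate hJ (n + k)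
  rw [← h, mem_preimage, hzx]
  exact hx₀J

/-- Points returning to a small interval `A` around `x₀` can be followed by full pull-backs. -/
theorem exists_pullBack_data_interval (hab : a ≤ b) {f : Icc a b → Icc a b} (hf : Continuous f)
    (hJ : f ⁻¹' juliaSet f = juliaSet f) (hex : TopologicallyExactOnJulia f) {β ρ C₀ : ℝ}
    (hβ : 0 < β)
    (hP : ∀ x ∈ juliaSet f, ∀ n : ℕ, 1 ≤ n → ∀ W : Set (Icc a b),
      IsPullBack f n (Metric.ball x ρ) W → Metric.diam W ≤ C₀ * (n : ℝ) ^ (-β))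
    {x₀ : Icc a b} (hx₀ : x₀ ∈ juliaSet f) {r : ℝ} (hr : 0 < r) (hrρ : r < ρ)
    {j₁ j₂ : Icc a b} (hj₁ : j₁ ∈ juliaSet f) (hj₂ : j₂ ∈ juliaSet f)
    (hj₁r : (j₁ : ℝ) ≤ x₀ - r) (hj₂r : (x₀ : ℝ) + r ≤ j₂) {q₁ q₂ : ℝ}
    {p₁ p₃ : Icc a b} (hp₁ : p₁ ∈ juliaSet f) (hp₃ : p₃ ∈ juliaSet f)
    (hp₁q : (p₁ : ℝ) ∈ Ioo (x₀ - r) q₁) (hp₃q : (p₃ : ℝ) ∈ Ioo q₂ (x₀ + r)) :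
    ∃ K N₀ : ℕ, ∀ n, N₀ ≤ n → ∀ y ∈ (↑) ⁻¹' Ioo q₁ q₂ ∩ juliaSet f,
      f^[n] y ∈ ((↑) ⁻¹' Ioo q₁ q₂ : Set (Icc a b)) → ∃ k ≤ K, ∃ W,
      IsPullBack f (n + k) ((↑) ⁻¹' Icc (x₀ - r : ℝ) (x₀ + r)) W ∧
      f^[n + k] '' W = (↑) ⁻¹' Icc (x₀ - r : ℝ) (x₀ + r) ∧
      (W ∩ juliaSet f ∩ connectedComponentIn (f^[n] ⁻¹' Metric.ball x₀ ρ) y).Nonempty := by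
  have hopen : ∀ e e' : ℝ, IsOpen ((↑) ⁻¹' Ioo e e' : Set (Icc a b)) := fun e e' =>
    isOpen_Ioo.preimage continuous_subtype_val
  -- The outer pieces do not depend on `n` or `y`, so these two exactness times bound `k` uniformly.
  obtain ⟨kL, hkL⟩ := hex _ (hopen (x₀ - r) q₁) ⟨p₁, hp₁q, hp₁⟩
  obtain ⟨kR, hkR⟩ := hex _ (hopen q₂ (x₀ + r)) ⟨p₃, hp₃q, hp₃⟩
  have hba : 0 < b - a := by
    have h1 := x₀.2.1
    have h2 := j₂.2.2
    linarith
  have hlim : Tendsto (fun n : ℕ => C₀ * (n : ℝ) ^ (-β)) atTop (𝓝 0) := by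
    have := ((tendsto_rpow_neg_atTop hβ).comp tendsto_natCast_atTop_atTop).const_mul C₀
    simpa using this
  obtain ⟨N₀, hN₀⟩ := eventually_atTop.1
    ((hlim.eventually_lt_const hba).and (eventually_ge_atTop 1))
  refine ⟨max kL kR, N₀, fun n hn y ⟨hyA, hyJ⟩ hnA => ?_⟩
  obtain ⟨hnb, hn1⟩ := hN₀ n hn
  set G : ℝ → ℝ := fun t => (f^[n] (projIcc a b hab t) : ℝ) with hG
  have hGc : Continuous G :=
    continuous_subtype_val.comp ((hf.iterate _).comp continuous_projIcc)
  -- Otherwise the whole interval would be a pull-back of the ball, too long for `n ≥ N₀`.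
  obtain ⟨u, hu⟩ : ∃ u, f^[n] u ∉ Metric.ball x₀ ρ := by
    by_contra! hall
    have : PreconnectedSpace (Icc a b) := Subtype.preconnectedSpace isPreconnected_Icc
    have h1 := dist_le_of_isPreconnected_subset_preimage (hP x₀ hx₀ n hn1)
      (isPreconnected_univ (α := Icc a b)) (fun w _ => hall w)
      (mem_univ ⟨b, right_mem_Icc.2 hab⟩) (mem_univ ⟨a, left_mem_Icc.2 hab⟩)
    rw [Subtype.dist_eq, Real.dist_eq] at h1
    linarith [le_abs_self (b - a)]
  have hGval : ∀ w : Icc a b, G w = f^[n] w := fun w => by simp only [hG, projIcc_val]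
  have hGu : G u ∉ Ioo (x₀ - r : ℝ) (x₀ + r) := by
    intro h
    rw [hGval] at h
    refine hu ?_
    rw [Metric.mem_ball, Subtype.dist_eq, Real.dist_eq, abs_lt]
    constructor <;> linarith [h.1, h.2]
  have hGy : G y ∈ Ioo q₁ q₂ := by rw [hGval]; exact hnA
  have hGy' : G y ∈ Icc (x₀ - r : ℝ) (x₀ + r) :=
    ⟨by linarith [hGy.1, hp₁q.1, hp₁q.2], by linarith [hGy.2, hp₃q.1, hp₃q.2]⟩
  -- Up to `v` the image stays in `[x₀ - r, x₀ + r]`, hence in the ball. It joins a point of `(q₁,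
  -- q₂)` to an endpoint, so it covers the outer piece on that side.
  obtain ⟨v, -, hvim, hvend⟩ := exists_image_uIcc_subset_Icc hGc hGy' hGu
  have hcomp : projIcc a b hab '' uIcc (y : ℝ) v ⊆
      connectedComponentIn (f^[n] ⁻¹' Metric.ball x₀ ρ) y := by
    refine (isPreconnected_uIcc.image _
      continuous_projIcc.continuousOn).subset_connectedComponentIn
        ⟨y, left_mem_uIcc, projIcc_val hab y⟩ ?_
    rintro _ ⟨w, hw, rfl⟩
    have h := hvim (mem_image_of_mem G hw)
    rw [mem_preimage, Metric.mem_ball, Subtype.dist_eq, Real.dist_eq, abs_lt]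
    constructor <;> linarith [h.1, h.2, show G w = f^[n] (projIcc a b hab w) from rfl]
  have hx₀r : (x₀ : ℝ) ∈ Icc (x₀ - r : ℝ) (x₀ + r) := ⟨by linarith, by linarith⟩
  have hfin : ∀ k ≤ max kL kR, ∀ U : Set (Icc a b), f^[k] '' (U ∩ juliaSet f) = juliaSet f →
      (∀ x ∈ U, (x : ℝ) ∈ uIcc (G y) (G v)) → ∃ k ≤ max kL kR, ∃ W,
      IsPullBack f (n + k) ((↑) ⁻¹' Icc (x₀ - r : ℝ) (x₀ + r)) W ∧
      f^[n + k] '' W = (↑) ⁻¹' Icc (x₀ - r : ℝ) (x₀ + r) ∧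
      (W ∩ juliaSet f ∩ connectedComponentIn (f^[n] ⁻¹' Metric.ball x₀ ρ) y).Nonempty := by
    intro k hk U hU hUG
    obtain ⟨W, h1, h2, h3⟩ := exists_isPullBack_of_covers_julia hab hf hJ
      (hx₀r.1.trans hx₀r.2) hj₁ hj₂ hj₁r hj₂r hx₀ hx₀r hU (n := n) (y := y) (v := v) (by
        intro x hx
        obtain ⟨w, hw, hwx⟩ := intermediate_value_uIcc hGc.continuousOn (hUG x hx)
        exact ⟨w, hw, Subtype.ext hwx⟩)
    exact ⟨k, hk, W, h1, h2, h3.mono (inter_subset_inter_right _ hcomp)⟩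
  rcases hvend with hv | hv
  · refine hfin kL (le_max_left _ _) _ hkL fun x hx => ?_
    rw [hv]
    exact mem_uIcc_of_ge hx.1.le (hx.2.trans hGy.1).le
  · refine hfin kR (le_max_right _ _) _ hkR fun x hx => ?_
    rw [hv]
    exact mem_uIcc_of_le (hGy.2.trans hx.1).le hx.2.le

theorem exists_three_lt_of_infinite {T : Set ℝ} (hT : T.Infinite) :
    ∃ p₁ ∈ T, ∃ p₂ ∈ T, ∃ p₃ ∈ T, p₁ < p₂ ∧ p₂ < p₃ := by
  obtain ⟨F, hF, hcard⟩ := hT.exists_subset_card_eq 3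
  refine ⟨_, hF (F.orderEmbOfFin_mem hcard 0), _, hF (F.orderEmbOfFin_mem hcard 1), _,
    hF (F.orderEmbOfFin_mem hcard 2), ?_, ?_⟩ <;>
  · rw [OrderEmbedding.lt_iff_lt]
    decide

theorem exists_full_measure_isFree_IMFS_interval {β : ℝ} (hβ : 0 < β) {α : ℝ≥0}
    (hαβ : 1 < β * α) (hab : a ≤ b) {f : Icc a b → Icc a b} (hf : IsClassAReal hab f)
    (hex : TopologicallyExactOnJulia f) (hP : PolynomialShrinking f β) {φ : Icc a b → ℝ}
    {C : ℝ≥0} (hφ : HolderOnWith C α φ (juliaSet f)) {ν : Measure (Icc a b)}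
    [IsProbabilityMeasure ν] (hνJ : ν (juliaSet f)ᶜ = 0) (hν : Ergodic f ν)
    (hper : ¬ SupportedOnPeriodicOrbit f ν) :
    ∃ X ⊆ juliaSet f, ν Xᶜ = 0 ∧ ∀ x₀ ∈ X,
      ∃ D > (0 : ℝ), ∃ B₀ : Set (Icc a b), x₀ ∈ B₀ ∧ ∃ Φ : IMFS f B₀, Φ.IsFree ∧
        ∀ l, ∀ y ∈ Φ.branchImage l B₀ ∩ juliaSet f,
          Φ.time l * (∫ x in juliaSet f, φ x ∂ν) - D ≤ birkhoffSum f φ (Φ.time l) y := by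
  have hfc : Continuous f := hf.isC3NonFlat.continuous
  have hν0 : ∀ x, ν {x} = 0 := hν.measure_singleton_eq_zero hper
  obtain ⟨ρ, hρ, C₀, hC₀, hP⟩ := hP
  have hJc : IsCompact (juliaSet f) := isClosed_juliaSet.isCompact
  obtain ⟨j₁, hj₁, hmin⟩ := hJc.exists_isMinOn hf.nontrivial_julia.nonempty
    continuous_subtype_val.continuousOn
  obtain ⟨j₂, hj₂, hmax⟩ := hJc.exists_isMaxOn hf.nontrivial_julia.nonempty
    continuous_subtype_val.continuousOn
  -- Omitting the two extreme points of the Julia set, which are null, leaves room for `[x₀ - r, x₀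
  -- + r]` between them.
  refine ⟨{x | x ∈ juliaSet f ∧ (∀ t ∈ 𝓝 x, 0 < ν t) ∧ x ≠ j₁ ∧ x ≠ j₂}, fun x hx => hx.1, ?_, ?_⟩
  · refine mem_ae_iff.1 ?_
    filter_upwards [show ∀ᵐ x ∂ν, x ∈ juliaSet f from mem_ae_iff.2 hνJ,
      ae_forall_mem_nhds_measure_pos ν, measure_eq_zero_iff_ae_notMem.1 (hν0 j₁),
      measure_eq_zero_iff_ae_notMem.1 (hν0 j₂)] with x h1 h2 h3 h4
    exact ⟨h1, h2, h3, h4⟩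
  rintro x₀ ⟨hx₀, hx₀ν, hx₀1, hx₀2⟩
  have h1 : (j₁ : ℝ) < x₀ := lt_of_le_of_ne (hmin hx₀) fun h => hx₀1 (Subtype.ext h.symm)
  have h2 : (x₀ : ℝ) < j₂ := lt_of_le_of_ne (hmax hx₀) fun h => hx₀2 (Subtype.ext h)
  obtain ⟨r, hr, hrρ, hr1, hr2⟩ : ∃ r > (0 : ℝ), r < ρ ∧ (j₁ : ℝ) ≤ x₀ - r ∧
      (x₀ : ℝ) + r ≤ j₂ := by
    refine ⟨min (ρ / 2) (min (x₀ - j₁) (j₂ - x₀)), by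
      refine lt_min (by linarith) (lt_min (by linarith) (by linarith)), ?_, ?_, ?_⟩
    · linarith [min_le_left (ρ / 2) (min ((x₀ : ℝ) - j₁) (j₂ - x₀))]
    · linarith [(min_le_right (ρ / 2) (min ((x₀ : ℝ) - j₁) (j₂ - x₀))).trans (min_le_left _ _)]
    · linarith [(min_le_right (ρ / 2) (min ((x₀ : ℝ) - j₁) (j₂ - x₀))).trans (min_le_right _ _)]
  set U : Set (Icc a b) := (↑) ⁻¹' Ioo (x₀ - r : ℝ) (x₀ + r) with hU
  have hUo : IsOpen U := isOpen_Ioo.preimage continuous_subtype_val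
  have hUν : ν (U ∩ juliaSet f) ≠ 0 := by
    rw [measure_inter_conull hνJ]
    exact (hx₀ν U (hUo.mem_nhds ⟨by linarith, by linarith⟩)).ne'
  -- A non-atomic measure has infinitely many support points near `x₀`. The middle one gives `A`
  -- positive measure; the outer two supply Julia points on both sides of `A`.
  obtain ⟨_, ⟨p₁, ⟨⟨hp₁U, hp₁J⟩, -⟩, rfl⟩, _, ⟨p₂, ⟨⟨hp₂U, hp₂J⟩, hp₂ν⟩, rfl⟩,
    _, ⟨p₃, ⟨⟨hp₃U, hp₃J⟩, -⟩, rfl⟩, h12, h23⟩ := exists_three_lt_of_infinite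
      ((infinite_setOf_forall_mem_nhds_measure_pos hν0 hUν).image
        (Subtype.val_injective.injOn))
  obtain ⟨q₁, hq11, hq12⟩ := exists_between h12
  obtain ⟨q₂, hq21, hq22⟩ := exists_between h23
  obtain ⟨K, N₀, H⟩ := exists_pullBack_data_interval hab hfc hf.completelyInvariant hex hβ hP hx₀
    hr hrρ hj₁ hj₂ hr1 hr2 hp₁J hp₃J ⟨hp₁U.1, hq11⟩ ⟨hq22, hp₃U.2⟩
  have hAo : IsOpen ((↑) ⁻¹' Ioo q₁ q₂ : Set (Icc a b)) :=
    isOpen_Ioo.preimage continuous_subtype_val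
  have hx₀B : x₀ ∈ ((↑) ⁻¹' Icc (x₀ - r : ℝ) (x₀ + r) : Set (Icc a b)) :=
    ⟨by linarith, by linarith⟩
  have hB : ((↑) ⁻¹' Icc (x₀ - r : ℝ) (x₀ + r) : Set (Icc a b)) =
      projIcc a b hab '' Icc (x₀ - r : ℝ) (x₀ + r) := by
    ext x
    constructor
    · intro hx
      exact ⟨x, hx, projIcc_val hab x⟩
    · rintro ⟨w, hw, rfl⟩
      have hwab : w ∈ Icc a b :=
        ⟨by linarith [hw.1, j₁.2.1], by linarith [hw.2, j₂.2.2]⟩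
      rw [mem_preimage, projIcc_of_mem hab hwab]
      exact hw
  obtain ⟨D, hD, hΦ⟩ := exists_isFree_IMFS hfc hβ hαβ hC₀.le hP hφ hνJ hν hper hx₀
    (B₀ := (↑) ⁻¹' Icc (x₀ - r : ℝ) (x₀ + r))
    ((isClosed_Icc.preimage continuous_subtype_val).isCompact)
    (by
      rw [hB]
      exact (isConnected_Icc (by linarith)).image _ continuous_projIcc.continuousOn)
    hx₀B
    (by
      intro x hx
      rw [Metric.mem_ball, Subtype.dist_eq, Real.dist_eq, abs_lt]
      constructor <;> linarith [hx.1, hx.2])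
    hAo
    (fun x hx => ⟨by linarith [hx.1, hp₁U.1], by linarith [hx.2, hp₃U.2]⟩)
    (hp₂ν _ (hAo.mem_nhds ⟨hq12, hq21⟩)).ne' K N₀ H
  exact ⟨D, hD, _, hx₀B, hΦ⟩

end Interval

/-! ### Open maps and components of preimages -/

/-- A continuous open self-map of a compact Hausdorff space maps every component of the preimage of
a closed connected set onto that set. -/
theorem IsOpenMap.image_connectedComponentIn_preimage {X : Type*} [TopologicalSpace X]
    [CompactSpace X] [T2Space X] {g : X → X} (hg : IsOpenMap g) (hgc : Continuous g) {K : Set X}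
    (hK : IsClosed K) (hKc : IsConnected K) {x : X} (hx : g x ∈ K) :
    g '' connectedComponentIn (g ⁻¹' K) x = K := by
  refine Subset.antisymm (image_subset_iff.2 (connectedComponentIn_subset _ _)) fun k hk => ?_
  have hYc : IsClosed (g ⁻¹' K) := hK.preimage hgc
  have : CompactSpace (g ⁻¹' K) := isCompact_iff_compactSpace.1 hYc.isCompact
  have : ConnectedSpace K := isConnected_iff_connectedSpace.1 hKc
  set h : g ⁻¹' K → K := K.restrictPreimage g with hh
  have hho : IsOpenMap h := hg.restrictPreimage K
  have hhc : Continuous h := hgc.restrictPreimage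
  have hhcl : IsClosedMap h := hhc.isClosedMap
  set x' : g ⁻¹' K := ⟨x, hx⟩
  -- The restriction to the preimage is open and closed, so a nonempty clopen set has clopen image,
  -- which is all of the connected `K`.
  have hsurj : ∀ Z : Set (g ⁻¹' K), IsClopen Z → x' ∈ Z → (Z ∩ h ⁻¹' {⟨k, hk⟩}).Nonempty := by
    intro Z hZ hxZ
    have hcl : IsClopen (h '' Z) := ⟨hhcl _ hZ.1, hho _ hZ.2⟩
    have huniv := hcl.eq_univ ⟨_, mem_image_of_mem h hxZ⟩
    obtain ⟨z, hz, hzk⟩ : (⟨k, hk⟩ : K) ∈ h '' Z := by rw [huniv]; exact mem_univ _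
    exact ⟨z, hz, hzk⟩
  -- The component is the intersection of the clopen sets around `x'`; each meets the fibre over
  -- `k`, and compactness gives a common point.
  have hne : (⋂ Z : { Z : Set (g ⁻¹' K) // IsClopen Z ∧ x' ∈ Z },
      (Z : Set (g ⁻¹' K)) ∩ h ⁻¹' {⟨k, hk⟩}).Nonempty := by
    have : Nonempty { Z : Set (g ⁻¹' K) // IsClopen Z ∧ x' ∈ Z } :=
      ⟨⟨univ, isClopen_univ, mem_univ _⟩⟩
    have hclosed : ∀ Z : { Z : Set (g ⁻¹' K) // IsClopen Z ∧ x' ∈ Z },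
        IsClosed ((Z : Set (g ⁻¹' K)) ∩ h ⁻¹' {⟨k, hk⟩}) := fun Z =>
      Z.2.1.1.inter (isClosed_singleton.preimage hhc)
    refine IsCompact.nonempty_iInter_of_directed_nonempty_isCompact_isClosed _ ?_
      (fun Z => hsurj Z Z.2.1 Z.2.2) (fun Z => (hclosed Z).isCompact) hclosed
    intro Z₁ Z₂
    exact ⟨⟨Z₁ ∩ Z₂, Z₁.2.1.inter Z₂.2.1, Z₁.2.2, Z₂.2.2⟩,
      inter_subset_inter_left _ inter_subset_left, inter_subset_inter_left _ inter_subset_right⟩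
  obtain ⟨z, hz⟩ := hne
  rw [mem_iInter] at hz
  have hzk : h z = ⟨k, hk⟩ := (hz ⟨univ, isClopen_univ, mem_univ _⟩).2
  refine ⟨z, ?_, congrArg Subtype.val hzk⟩
  rw [connectedComponentIn_eq_image (show x ∈ g ⁻¹' K from hx)]
  refine mem_image_of_mem _ ?_
  rw [connectedComponent_eq_iInter_isClopen]
  exact mem_iInter.2 fun Z => (hz Z).1

/-! ### Inversion and local connectedness of the sphere -/

namespace RiemannSphere

theorem nhds_ofComplex (z : ℂ) : 𝓝 (ofComplex z) = map ofComplex (𝓝 z) :=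
  OnePoint.nhds_coe_eq z

theorem continuous_ofComplex : Continuous ofComplex := OnePoint.continuous_coe

theorem nhds_infty_eq : 𝓝 infty = map ofComplex (Bornology.cobounded ℂ) ⊔ pure infty := by
  rw [Metric.cobounded_eq_cocompact, ← coclosedCompact_eq_cocompact]
  exact OnePoint.nhds_infty_eq

/-- The inversion of the Riemann sphere. -/
noncomputable def inversion (x : RiemannSphere) : RiemannSphere :=
  OnePoint.elim x (ofComplex 0) fun z : ℂ => if z = 0 then infty else ofComplex z⁻¹

theorem inversion_infty : inversion infty = ofComplex 0 := rfl

theorem inversion_zero : inversion (ofComplex 0) = infty := if_pos rfl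

theorem inversion_of_ne {z : ℂ} (hz : z ≠ 0) : inversion (ofComplex z) = ofComplex z⁻¹ :=
  if_neg hz

theorem inversion_inversion (x : RiemannSphere) : inversion (inversion x) = x := by
  induction x using OnePoint.rec with
  | infty => exact inversion_zero
  | coe z =>
    change inversion (inversion (ofComplex z)) = ofComplex z
    by_cases hz : z = 0
    · rw [hz, inversion_zero, inversion_infty]
    · rw [inversion_of_ne hz, inversion_of_ne (inv_ne_zero hz), inv_inv]

theorem continuous_inversion : Continuous inversion := by
  rw [continuous_iff_continuousAt]
  intro x
  induction x using OnePoint.rec with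
  | infty =>
    change Tendsto inversion (𝓝 infty) (𝓝 (inversion infty))
    rw [inversion_infty, nhds_infty_eq, tendsto_sup]
    refine ⟨?_, ?_⟩
    · rw [tendsto_map'_iff]
      have h1 : Tendsto (fun z : ℂ => ofComplex z⁻¹) (Bornology.cobounded ℂ) (𝓝 (ofComplex 0)) :=
        (continuous_ofComplex.tendsto 0).comp tendsto_inv₀_cobounded
      refine h1.congr' ?_
      filter_upwards [Bornology.eventually_ne_cobounded (0 : ℂ)] with z hz
      exact (inversion_of_ne hz).symm
    · rw [tendsto_pure_left]
      intro s hs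
      rw [inversion_infty]
      exact mem_of_mem_nhds hs
  | coe z =>
    change Tendsto inversion (𝓝 (ofComplex z)) (𝓝 (inversion (ofComplex z)))
    rw [nhds_ofComplex, tendsto_map'_iff]
    by_cases hz : z = 0
    · rw [hz, inversion_zero, ← nhdsNE_sup_pure (0 : ℂ), tendsto_sup]
      refine ⟨?_, ?_⟩
      · have h1 : Tendsto (fun z : ℂ => ofComplex z⁻¹) (𝓝[≠] 0) (𝓝 infty) := by
          rw [nhds_infty_eq]
          exact (tendsto_map.comp tendsto_inv₀_nhdsNE_zero).mono_right le_sup_left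
        refine h1.congr' ?_
        filter_upwards [self_mem_nhdsWithin] with w hw
        exact (inversion_of_ne hw).symm
      · rw [tendsto_pure_left]
        intro s hs
        rw [Function.comp_apply, inversion_zero]
        exact mem_of_mem_nhds hs
    · rw [inversion_of_ne hz]
      have h1 : Tendsto (fun z : ℂ => ofComplex z⁻¹) (𝓝 z) (𝓝 (ofComplex z⁻¹)) :=
        (continuous_ofComplex.tendsto _).comp (tendsto_inv₀ hz)
      refine h1.congr' ?_
      filter_upwards [eventually_ne_nhds hz] with w hw
      exact (inversion_of_ne hw).symm

/-- The inversion as a homeomorphism. -/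
noncomputable def inversionHomeomorph : RiemannSphere ≃ₜ RiemannSphere where
  toFun := inversion
  invFun := inversion
  left_inv := inversion_inversion
  right_inv := inversion_inversion
  continuous_toFun := continuous_inversion
  continuous_invFun := continuous_inversion

theorem map_inversion_nhds (x : RiemannSphere) : map inversion (𝓝 x) = 𝓝 (inversion x) :=
  inversionHomeomorph.map_nhds_eq x

/-- Closed discs serve at finite points, and inversion carries them to infinity. -/
theorem exists_isCompact_isConnected_mem_nhds (x : RiemannSphere) {U : Set RiemannSphere}
    (hU : U ∈ 𝓝 x) : ∃ B ∈ 𝓝 x, IsCompact B ∧ IsConnected B ∧ B ⊆ U := by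
  have hfin : ∀ z : ℂ, ∀ U ∈ 𝓝 (ofComplex z), ∃ B ∈ 𝓝 (ofComplex z),
      IsCompact B ∧ IsConnected B ∧ B ⊆ U := by
    intro z U hU
    rw [nhds_ofComplex, mem_map] at hU
    obtain ⟨r, hr, hrU⟩ := Metric.nhds_basis_closedBall.mem_iff.1 hU
    refine ⟨ofComplex '' Metric.closedBall z r, ?_,
      (isCompact_closedBall z r).image continuous_ofComplex,
      (Metric.isConnected_closedBall hr.le).image _ continuous_ofComplex.continuousOn,
      image_subset_iff.2 hrU⟩
    rw [nhds_ofComplex]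
    exact image_mem_map (Metric.closedBall_mem_nhds z hr)
  induction x using OnePoint.rec with
  | coe z => exact hfin z U hU
  | infty =>
    have h0 : inversion ⁻¹' U ∈ 𝓝 (ofComplex 0) :=
      continuous_inversion.continuousAt (by rw [inversion_zero]; exact hU)
    obtain ⟨B, hB, hBc, hBconn, hBU⟩ := hfin 0 _ h0
    refine ⟨inversion '' B, ?_, hBc.image continuous_inversion,
      hBconn.image _ continuous_inversion.continuousOn, image_subset_iff.2 hBU⟩
    have := image_mem_map (m := inversion) hB
    rwa [map_inversion_nhds, inversion_zero] at this

end RiemannSphere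

/-! ### Rational maps are continuous and open -/

section RationalMaps

open RiemannSphere

/-- The value of `p / q` at a point of the sphere, for `p` and `q` seen as forms of degree `N`. -/
noncomputable def rationalMapOfDegree (N : ℕ) (p q : ℂ[X]) (x : RiemannSphere) : RiemannSphere :=
  OnePoint.elim x
    (if q.coeff N = 0 then infty else ofComplex (p.coeff N / q.coeff N))
    (fun z : ℂ => if q.eval z = 0 then infty else ofComplex (p.eval z / q.eval z))

/-- `p` and `q`, seen as forms of positive degree `N`, have no common zero on the sphere. -/
structure IsCoprimeOfDegree (N : ℕ) (p q : ℂ[X]) : Prop where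
  pos : 0 < N
  left_le : p.natDegree ≤ N
  right_le : q.natDegree ≤ N
  eval_ne : ∀ z, p.eval z = 0 → q.eval z ≠ 0
  coeff_ne : p.coeff N = 0 → q.coeff N ≠ 0

theorem eval_reflect {N : ℕ} {p : ℂ[X]} (hp : p.natDegree ≤ N) {z : ℂ} (hz : z ≠ 0) :
    (reflect N p).eval z = z ^ N * p.eval z⁻¹ := by
  let _ : Invertible z⁻¹ := invertibleOfNonzero (inv_ne_zero hz)
  have h := eval₂_reflect_mul_pow (RingHom.id ℂ) z⁻¹ N p hp
  rw [invOf_eq_inv, inv_inv] at h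
  rw [eval, eval, ← h, inv_pow, mul_comm, mul_assoc, inv_mul_cancel₀ (pow_ne_zero N hz), mul_one]

theorem eval_zero_reflect (N : ℕ) (p : ℂ[X]) : (reflect N p).eval 0 = p.coeff N := by
  rw [← coeff_zero_eq_eval_zero, coeff_reflect, revAt_zero]

theorem coeff_self_reflect (N : ℕ) (p : ℂ[X]) : (reflect N p).coeff N = p.eval 0 := by
  rw [← coeff_zero_eq_eval_zero, coeff_reflect, revAt_le le_rfl, Nat.sub_self]

namespace IsCoprimeOfDegree

variable {N : ℕ} {p q : ℂ[X]}

theorem symm (h : IsCoprimeOfDegree N p q) : IsCoprimeOfDegree N q p :=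
  ⟨h.pos, h.right_le, h.left_le, fun z hq hp => h.eval_ne z hp hq, fun hq hp => h.coeff_ne hp hq⟩

theorem reflect (h : IsCoprimeOfDegree N p q) :
    IsCoprimeOfDegree N (p.reflect N) (q.reflect N) where
  pos := h.pos
  left_le := natDegree_reflect_le.trans (max_le le_rfl h.left_le)
  right_le := natDegree_reflect_le.trans (max_le le_rfl h.right_le)
  eval_ne z := by
    by_cases hz : z = 0
    · rw [hz, eval_zero_reflect, eval_zero_reflect]
      exact h.coeff_ne
    · rw [eval_reflect h.left_le hz, eval_reflect h.right_le hz]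
      intro h1
      exact mul_ne_zero (pow_ne_zero _ hz)
        (h.eval_ne _ ((mul_eq_zero.1 h1).resolve_left (pow_ne_zero _ hz)))
  coeff_ne := by
    rw [coeff_self_reflect, coeff_self_reflect]
    exact h.eval_ne 0

/-- Local constancy gives `p = c q` as polynomials. A root of `q` would be a common zero, so `q` is
constant; then, as `N > 0`, both coefficients of degree `N` vanish, which is a common zero at
infinity. -/
theorem not_eventually_const (h : IsCoprimeOfDegree N p q) {z c : ℂ} (hq : q.eval z ≠ 0) :
    ¬ ∀ᶠ w in 𝓝 z, p.eval w / q.eval w = c := by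
  intro hev
  have hqc : ∀ᶠ w in 𝓝 z, q.eval w ≠ 0 := q.continuous.continuousAt.eventually_ne hq
  have hzero : ∀ᶠ w in 𝓝 z, (p - C c * q).eval w = 0 := by
    filter_upwards [hev, hqc] with w h1 h2
    rw [div_eq_iff h2] at h1
    simp [h1]
  have hpq : p = C c * q := by
    rw [← sub_eq_zero]
    refine Polynomial.eq_zero_of_infinite_isRoot _ ?_
    exact infinite_of_mem_nhds z hzero
  have hq0 : q.degree = 0 := by
    by_contra hdeg
    obtain ⟨w, hw⟩ := IsAlgClosed.exists_root q hdeg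
    exact h.eval_ne w (by rw [hpq]; simp [hw.eq_zero]) hw
  have hqN : q.coeff N = 0 :=
    coeff_eq_zero_of_degree_lt (by rw [hq0]; exact_mod_cast h.pos)
  exact h.coeff_ne (by rw [hpq, coeff_C_mul, hqN, mul_zero]) hqN

theorem inversion_rationalMapOfDegree (h : IsCoprimeOfDegree N p q) (x : RiemannSphere) :
    inversion (rationalMapOfDegree N p q x) = rationalMapOfDegree N q p x := by
  have key : ∀ u v : ℂ, (u = 0 → v ≠ 0) →
      inversion (if v = 0 then infty else ofComplex (u / v)) =
        if u = 0 then infty else ofComplex (v / u) := by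
    intro u v huv
    by_cases hu : u = 0
    · rw [if_neg (huv hu), if_pos hu, hu, zero_div, inversion_zero]
    · by_cases hv : v = 0
      · rw [if_pos hv, if_neg hu, inversion_infty, hv, zero_div]
      · rw [if_neg hv, if_neg hu, inversion_of_ne (div_ne_zero hu hv), inv_div]
  induction x using OnePoint.rec with
  | infty => exact key _ _ h.coeff_ne
  | coe z => exact key _ _ (h.eval_ne z)

/-- Inverting the variable reverses the coefficients of forms of degree `N`, which reduces infinity
to the point `0`. -/
theorem rationalMapOfDegree_inversion (h : IsCoprimeOfDegree N p q) (x : RiemannSphere) :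
    rationalMapOfDegree N p q (inversion x) =
      rationalMapOfDegree N (p.reflect N) (q.reflect N) x := by
  induction x using OnePoint.rec with
  | infty =>
    change (if q.eval 0 = 0 then infty else ofComplex (p.eval 0 / q.eval 0)) =
      if (q.reflect N).coeff N = 0 then infty
        else ofComplex ((p.reflect N).coeff N / (q.reflect N).coeff N)
    rw [coeff_self_reflect, coeff_self_reflect]
  | coe z =>
    change rationalMapOfDegree N p q (inversion (ofComplex z)) =
      if (q.reflect N).eval z = 0 then infty
        else ofComplex ((p.reflect N).eval z / (q.reflect N).eval z)
    by_cases hz : z = 0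
    · rw [hz, inversion_zero, eval_zero_reflect, eval_zero_reflect]
      rfl
    · have hz' := pow_ne_zero N hz
      rw [inversion_of_ne hz, eval_reflect h.left_le hz, eval_reflect h.right_le hz,
        mul_div_mul_left _ _ hz']
      change (if q.eval z⁻¹ = 0 then infty else ofComplex (p.eval z⁻¹ / q.eval z⁻¹)) = _
      simp only [mul_eq_zero, hz', false_or]

/-- The equality of filters is continuity and openness at once; openness is the open mapping theorem
for the nonconstant analytic `p / q`. -/
theorem map_nhds_of_eval_ne (h : IsCoprimeOfDegree N p q) {z : ℂ} (hq : q.eval z ≠ 0) :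
    map (rationalMapOfDegree N p q) (𝓝 (ofComplex z)) =
      𝓝 (rationalMapOfDegree N p q (ofComplex z)) := by
  have hqc : ∀ᶠ w in 𝓝 z, q.eval w ≠ 0 := q.continuous.continuousAt.eventually_ne hq
  have hval : ∀ {w : ℂ}, q.eval w ≠ 0 →
      rationalMapOfDegree N p q (ofComplex w) = ofComplex (p.eval w / q.eval w) :=
    fun hw => if_neg hw
  have hana : ∀ r : ℂ[X], AnalyticAt ℂ (fun w => r.eval w) z := fun r =>
    r.differentiable.analyticAt z
  have hpq : AnalyticAt ℂ (fun w => p.eval w / q.eval w) z := (hana p).div (hana q) hq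
  have hmap : map (fun w => p.eval w / q.eval w) (𝓝 z) = 𝓝 (p.eval z / q.eval z) :=
    le_antisymm hpq.continuousAt (hpq.eventually_constant_or_nhds_le_map_nhds.resolve_left
      (h.not_eventually_const hq))
  rw [hval hq, nhds_ofComplex, nhds_ofComplex, ← hmap, map_map, map_map]
  refine Filter.map_congr ?_
  filter_upwards [hqc] with w hw
  exact hval hw

theorem map_nhds_ofComplex (h : IsCoprimeOfDegree N p q) (z : ℂ) :
    map (rationalMapOfDegree N p q) (𝓝 (ofComplex z)) =
      𝓝 (rationalMapOfDegree N p q (ofComplex z)) := by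
  by_cases hq : q.eval z = 0
  · have hp : p.eval z ≠ 0 := fun hp => h.eval_ne z hp hq
    -- At a pole, exchange `p` and `q` and invert the value.
    have h1 : rationalMapOfDegree N p q = inversion ∘ rationalMapOfDegree N q p :=
      funext fun x => (h.symm.inversion_rationalMapOfDegree x).symm
    rw [h1, ← map_map, h.symm.map_nhds_of_eval_ne hp, map_inversion_nhds]
    rfl
  · exact h.map_nhds_of_eval_ne hq

theorem map_nhds (h : IsCoprimeOfDegree N p q) (x : RiemannSphere) :
    map (rationalMapOfDegree N p q) (𝓝 x) = 𝓝 (rationalMapOfDegree N p q x) := by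
  induction x using OnePoint.rec with
  | coe z => exact h.map_nhds_ofComplex z
  | infty =>
    change map (rationalMapOfDegree N p q) (𝓝 infty) = 𝓝 (rationalMapOfDegree N p q infty)
    have h1 : rationalMapOfDegree N p q ∘ inversion =
        rationalMapOfDegree N (p.reflect N) (q.reflect N) :=
      funext h.rationalMapOfDegree_inversion
    rw [← inversion_zero, ← map_inversion_nhds, map_map, h1, h.reflect.map_nhds_ofComplex,
      ← h1, Function.comp_apply]

end IsCoprimeOfDegree

theorem isCoprimeOfDegree_max {p q : ℂ[X]} (h : IsCoprime p q)
    (hdeg : 0 < max p.natDegree q.natDegree) :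
    IsCoprimeOfDegree (max p.natDegree q.natDegree) p q where
  pos := hdeg
  left_le := le_max_left _ _
  right_le := le_max_right _ _
  eval_ne z hp hq := by
    obtain ⟨u, v, huv⟩ := h
    have := congrArg (eval z) huv
    simp [hp, hq] at this
  coeff_ne hp hq := by
    have key : ∀ r : ℂ[X], r.coeff r.natDegree = 0 → r.natDegree = 0 := by
      intro r hr
      rw [coeff_natDegree, leadingCoeff_eq_zero] at hr
      rw [hr, natDegree_zero]
    rcases max_choice p.natDegree q.natDegree with hm | hm
    · rw [hm] at hp hdeg
      exact hdeg.ne' (key p hp)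
    · rw [hm] at hq hdeg
      exact hdeg.ne' (key q hq)

theorem IsClassAComplex.map_nhds {f : RiemannSphere → RiemannSphere} (hf : IsClassAComplex f)
    (x : RiemannSphere) : map f (𝓝 x) = 𝓝 (f x) := by
  obtain ⟨p, q, hpq, hdeg, rfl⟩ := hf
  exact (isCoprimeOfDegree_max hpq (by omega)).map_nhds x

theorem IsClassAComplex.continuous {f : RiemannSphere → RiemannSphere} (hf : IsClassAComplex f) :
    Continuous f :=
  continuous_iff_continuousAt.2 fun x => (hf.map_nhds x).le

theorem IsClassAComplex.isOpenMap {f : RiemannSphere → RiemannSphere} (hf : IsClassAComplex f) :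
    IsOpenMap f :=
  IsOpenMap.of_nhds_le fun x => (hf.map_nhds x).ge

end RationalMaps

/-! ### The complex case and conclusion -/

theorem IsOpenMap.iterate {X : Type*} [TopologicalSpace X] {f : X → X} (hf : IsOpenMap f) (n : ℕ) :
    IsOpenMap f^[n] := by
  induction n with
  | zero => exact IsOpenMap.id
  | succ n ih => exact ih.comp hf

/-- The result for open maps of compact spaces in which every point has arbitrarily small compact
connected neighbourhoods. -/
theorem exists_full_measure_isFree_IMFS_of_isOpenMap {X : Type*} [MetricSpace X] [CompactSpace X]
    [MeasurableSpace X] [BorelSpace X]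
    (hX : ∀ x : X, ∀ U ∈ 𝓝 x, ∃ B ∈ 𝓝 x, IsCompact B ∧ IsConnected B ∧ B ⊆ U)
    {β : ℝ} (hβ : 0 < β) {α : ℝ≥0}
    (hαβ : 1 < β * α) {f : X → X} (hfc : Continuous f) (hfo : IsOpenMap f)
    (hP : PolynomialShrinking f β) {φ : X → ℝ}
    {C : ℝ≥0} (hφ : HolderOnWith C α φ (juliaSet f)) {ν : Measure X}
    [IsProbabilityMeasure ν] (hνJ : ν (juliaSet f)ᶜ = 0) (hν : Ergodic f ν)
    (hper : ¬ SupportedOnPeriodicOrbit f ν) :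
    ∃ X₀ ⊆ juliaSet f, ν X₀ᶜ = 0 ∧ ∀ x₀ ∈ X₀,
      ∃ D > (0 : ℝ), ∃ B₀ : Set X, x₀ ∈ B₀ ∧ ∃ Φ : IMFS f B₀, Φ.IsFree ∧
        ∀ l, ∀ y ∈ Φ.branchImage l B₀ ∩ juliaSet f,
          Φ.time l * (∫ x in juliaSet f, φ x ∂ν) - D ≤ birkhoffSum f φ (Φ.time l) y := by
  obtain ⟨ρ, hρ, C₀, hC₀, hP⟩ := hP
  refine ⟨{x | x ∈ juliaSet f ∧ ∀ t ∈ 𝓝 x, 0 < ν t}, fun x hx => hx.1, ?_, ?_⟩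
  · refine mem_ae_iff.1 ?_
    filter_upwards [show ∀ᵐ x ∂ν, x ∈ juliaSet f from mem_ae_iff.2 hνJ,
      ae_forall_mem_nhds_measure_pos ν] with x h1 h2
    exact ⟨h1, h2⟩
  rintro x₀ ⟨hx₀, hx₀ν⟩
  obtain ⟨B₀, hB₀n, hB₀c, hB₀, hB₀ρ⟩ := hX x₀ _ (Metric.ball_mem_nhds x₀ hρ)
  -- Here `A` is the interior of `B₀`, and `K = N₀ = 0`: the component of `f^{-n}(B₀)` containing
  -- `y` is already mapped onto `B₀`.
  obtain ⟨D, hD, hΦ⟩ := exists_isFree_IMFS hfc hβ hαβ hC₀.le hP hφ hνJ hν hper hx₀ hB₀c hB₀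
    (mem_of_mem_nhds hB₀n) hB₀ρ isOpen_interior interior_subset
    (hx₀ν _ (interior_mem_nhds.2 hB₀n)).ne' 0 0 (by
      rintro n - y ⟨-, hyJ⟩ hny
      have hy : f^[n] y ∈ B₀ := interior_subset hny
      refine ⟨0, le_rfl, connectedComponentIn (f^[n] ⁻¹' B₀) y, ⟨y, hy, rfl⟩,
        (IsOpenMap.iterate hfo n).image_connectedComponentIn_preimage (hfc.iterate n) hB₀c.isClosed hB₀ hy,
        y, ⟨mem_connectedComponentIn hy, hyJ⟩, mem_connectedComponentIn (hB₀ρ hy)⟩)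
  exact ⟨D, hD, B₀, mem_of_mem_nhds hB₀n, hΦ⟩

theorem propositionp (β : ℝ) (hβ : 1 < β) (α : ℝ≥0) (hα : β⁻¹ < (α : ℝ)) (hα1 : α ≤ 1) :
    (∀ (a b : ℝ) (hab : a ≤ b) (f : Icc a b → Icc a b),
        IsClassAReal hab f → TopologicallyExactOnJulia f → PolynomialShrinking f β →
          ∀ φ : Icc a b → ℝ,
            (∃ C : ℝ≥0, HolderOnWith C α φ (juliaSet f)) →
          ∀ ν : Measure (Icc a b), IsProbabilityMeasure ν → ν (juliaSet f)ᶜ = 0 → Ergodic f ν →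
            ¬ SupportedOnPeriodicOrbit f ν →
          ∃ X ⊆ juliaSet f, ν Xᶜ = 0 ∧ ∀ x₀ ∈ X,
            ∃ D > (0 : ℝ), ∃ B₀ : Set (Icc a b), x₀ ∈ B₀ ∧ ∃ Φ : IMFS f B₀, Φ.IsFree ∧
              ∀ l, ∀ y ∈ Φ.branchImage l B₀ ∩ juliaSet f,
                Φ.time l * (∫ x in juliaSet f, φ x ∂ν) - D ≤ birkhoffSum f φ (Φ.time l) y) ∧
    (∀ f : RiemannSphere → RiemannSphere,
        IsClassAComplex f → PolynomialShrinking f β →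
          ∀ φ : RiemannSphere → ℝ,
            (∃ C : ℝ≥0, HolderOnWith C α φ (juliaSet f)) →
          ∀ ν : Measure RiemannSphere, IsProbabilityMeasure ν → ν (juliaSet f)ᶜ = 0 → Ergodic f ν →
            ¬ SupportedOnPeriodicOrbit f ν →
          ∃ X ⊆ juliaSet f, ν Xᶜ = 0 ∧ ∀ x₀ ∈ X,
            ∃ D > (0 : ℝ), ∃ B₀ : Set RiemannSphere, x₀ ∈ B₀ ∧ ∃ Φ : IMFS f B₀, Φ.IsFree ∧
              ∀ l, ∀ y ∈ Φ.branchImage l B₀ ∩ juliaSet f,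
                Φ.time l * (∫ x in juliaSet f, φ x ∂ν) - D ≤ birkhoffSum f φ (Φ.time l) y) := by

  have hβ0 : 0 < β := one_pos.trans hβ
  have hαβ : 1 < β * α := by rwa [inv_lt_iff_one_lt_mul₀' hβ0] at hα
  refine ⟨?_, ?_⟩
  · intro a b hab f hf hex hP φ ⟨C, hφ⟩ ν _ hνJ hν hper
    exact exists_full_measure_isFree_IMFS_interval hβ0 hαβ hab hf hex hP hφ hνJ hν hper
  · intro f hf hP φ ⟨C, hφ⟩ ν _ hνJ hν hper
    -- The spherical metric was built on the one-point compactification topology, so compactness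
    -- transfers definitionally.
    have : @CompactSpace RiemannSphere
        (inferInstance : MetricSpace RiemannSphere).toUniformSpace.toTopologicalSpace :=
      inferInstanceAs (CompactSpace (OnePoint ℂ))
    exact exists_full_measure_isFree_IMFS_of_isOpenMap
      (fun x U hU => RiemannSphere.exists_isCompact_isConnected_mem_nhds x hU) hβ0 hαβ
      hf.continuous hf.isOpenMap hP hφ hνJ hν hper
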